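/- Throughout, all groups are finite. Let $G$ be a group, let $\mathrm{Irr}(G)$ be the set of its irreducible complex characters, and for $\chi \in \mathrm{Irr}(G)$ let $Z(\chi) = \{ g \in G : |\chi(g)| = \chi(1) \}$ be the center of $\chi$. The group $G$ is nested if for all $\chi, \psi \in \mathrm{Irr}(G)$ either $Z(\chi) \le Z(\psi)$ or $Z(\psi) \le Z(\chi)$; in that case the distinct subgroups of the form $Z(\chi)$, $\chi \in \mathrm{Irr}(G)$, form a chain $G = X_0 > X_1 > \dots > X_n$, called the chain of centers of $G$. Let $p$ be a prime. A $p$-group $H$ is extraspecial if $|Z(H)| = p$ and $Z(H) = H' = \Phi(H)$ (the Frattini subgroup); it is semi-extraspecial if $H/N$ is extraspecial for every subgroup $N$ of index $p$ in $Z(H)$; and it is ultraspecial if it is semi-extraspecial and $|H:Z(H)| = |Z(H)|^2$. Theorem. Let $G$ be a nonabelian nested $p$-group with chain of centers $G = X_0 > X_1 > \dots > X_n > 1$. Then: (1) $|G:X_1|$ is a square. (2) If $G' \le X_i$ for some integer $i$ with $1 \le i \le n$, then $|G:X_j|$ is a square for all integers $j$ with $1 \le j \le i$. (3) If $N$ is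 a subgroup of $G$ satisfying $[X_1,G] \le N < NG' = X_1$, then $N$ is normal in $G$ and $G/N$ is semi-extraspecial. (4) If $n \ge 2$ and $X_2 < X_2G'$, then $|G:X_1| = |X_2G':X_2|^2 = |G':[X_1,G]|^2$, $X_2 \cap G' = [X_1,G]$, and there exists a normal subgroup $A$ of $G$ with $X_2 \le A < X_1$ such that $G/A$ is ultraspecial. -/

import Mathlib

/-- `Irr(G)`: the set of characters of irreducible finite-dimensional complex representations of
`G`. Every such representation is equivalent to one on some `ℂ ^ d`, so nothing is lost by taking
these as the underlying spaces. An irreducible representation is nonzero by definition. -/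
def Irr (G : Type*) [Group G] : Set (G → ℂ) :=
  {χ | ∃ (d : ℕ) (ρ : Representation ℂ G (Fin d → ℂ)), ρ.IsIrreducible ∧ ρ.character = χ}

/-- The center `Z(χ) = {g ∈ G : |χ(g)| = χ(1)}` of a character `χ` (as a subset of `G`). -/
def charCenter {G : Type*} [Group G] (χ : G → ℂ) : Set G :=
  {g | ((‖χ g‖ : ℝ) : ℂ) = χ 1}

/-- `G` is nested: the centers of any two irreducible characters are comparable. -/
def IsNested (G : Type*) [Group G] : Prop :=
  ∀ χ ∈ Irr G, ∀ ψ ∈ Irr G, charCenter χ ⊆ charCenter ψ ∨ charCenter ψ ⊆ charCenter χ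

/-- `X 0 > X 1 > ⋯ > X n` is the chain of centers of `G`: the terms are strictly decreasing, and
they are exactly the centers of the irreducible characters of `G`. (The values `X i` with `n < i`
play no role.) -/
structure IsChainOfCenters {G : Type*} [Group G] (n : ℕ) (X : ℕ → Subgroup G) : Prop where
  top : X 0 = ⊤
  anti : ∀ i j : ℕ, i < j → j ≤ n → X j < X i
  center_mem : ∀ χ ∈ Irr G, ∃ i ≤ n, charCenter χ = (X i : Set G)
  exists_char : ∀ i ≤ n, ∃ χ ∈ Irr G, charCenter χ = (X i : Set G)

/-- `G` is an extraspecial `p`-group: a `p`-group whose center has order `p` and coincides with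
the derived subgroup and with the Frattini subgroup. -/
structure IsExtraspecial (p : ℕ) (G : Type*) [Group G] : Prop where
  isPGroup : IsPGroup p G
  card_center : Nat.card (Subgroup.center G) = p
  commutator_eq : commutator G = Subgroup.center G
  frattini_eq : frattini G = Subgroup.center G

/-- `G` is a semi-extraspecial `p`-group: a `p`-group such that `G / N` is extraspecial for every
subgroup `N` of index `p` in `Z(G)`. (A subgroup of `Z(G)` is always normal in `G`; the instance
argument only serves to form the quotient group.) -/
structure IsSemiExtraspecial (p : ℕ) (G : Type*) [Group G] : Prop where
  isPGroup : IsPGroup p G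
  quotient : ∀ (N : Subgroup G) [N.Normal], N ≤ Subgroup.center G →
    N.relIndex (Subgroup.center G) = p → IsExtraspecial p (G ⧸ N)

/-- `G` is an ultraspecial `p`-group: it is semi-extraspecial and `|G : Z(G)| = |Z(G)|²`. -/
structure IsUltraspecial (p : ℕ) (G : Type*) [Group G] : Prop where
  isSemiExtraspecial : IsSemiExtraspecial p G
  index_center : (Subgroup.center G).index = Nat.card (Subgroup.center G) ^ 2

/-! Everything rests on a separation property of the chain. If `x ∉ X (i+1)` and `[x, G] ≤ N` with
`N` normal, then `[X i, G] ≤ N`. Otherwise some irreducible `ρ` trivial on `N` moves some `[y, g]`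
with `y ∈ X i`; its center misses `y`, so it is some `X j` with `j > i`, yet it contains `x`. For `i
= 0` the conclusion reads `G' ≤ N`.

Parts (1) and (2): by Schur's lemma, a character whose center contains `G'` vanishes off its center,
so orthogonality gives `|G : Z(χ)| = χ(1)²`. In a `p`-group, separation also gives `[X i, G] ≤ X
(i+1)`, hence `G' ≤ X 1`. Part (3): separation makes `X 1 / N = G'N / N` the center of `G / N`, and
then the center of each quotient by a subgroup of index `p` in it is no larger than its image.

Part (4) squeezes `|G : X 1|` between two squares. Lower bound: in the class-two group `G / [X 1,
G]` every nonzero functional on the derived subgroup turns the commutator map into a nondegenerate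
alternating form. The Pfaffian of the generic form has only the trivial zero, so Chevalley–Warning
yields `|G' : [X 1, G]|² ≤ |G : X 1|`. Upper bound: modulo a suitable `M` of index `p` in `[X 1,
G]`, two pairings through the centralizer of `G'` yield `|G : X 1| ≤ |G' : G' ∩ X 2|²`. As `[X 1, G]
≤ G' ∩ X 2`, equality holds throughout. A complement `A` to `X 2 G'` in `X 1` modulo `X 2` then
gives the ultraspecial quotient. -/

open scoped commutatorElement

/-! ### Irreducible representations separate elements -/

/-- A representation on a finite-dimensional space, transported to a coordinate space. -/
theorem Representation.exists_coordinates {k G V : Type*} [Field k] [Group G]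
    [AddCommGroup V] [Module k V] [FiniteDimensional k V] (σ : Representation k G V) :
    ∃ (ρ : Representation k G (Fin (Module.finrank k V) → k)), ∀ g, ρ g = 1 ↔ σ g = 1 := by
  let e : V ≃ₗ[k] (Fin (Module.finrank k V) → k) := (Module.finBasis k V).equivFun
  refine ⟨(e.conjRingEquiv : Module.End k V →* Module.End k _).comp σ, fun g => ?_⟩
  exact e.conjRingEquiv.map_eq_one_iff

theorem Representation.exists_irreducible_of_apply_ne_one {G : Type*} [Group G] [Finite G] (g : G)
    (n : ℕ) (σ : Representation ℂ G (Fin n → ℂ)) (hσ : σ g ≠ 1) :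
    ∃ (d : ℕ) (ρ : Representation ℂ G (Fin d → ℂ)), ρ.IsIrreducible ∧
      (∀ x, σ x = 1 → ρ x = 1) ∧ ρ g ≠ 1 := by
  induction n using Nat.strong_induction_on with
  | _ n ih =>
    by_cases hirr : σ.IsIrreducible
    · exact ⟨n, σ, hirr, fun _ h => h, hσ⟩
    have : NeZero (Nat.card G : ℂ) := ⟨by exact_mod_cast Nat.card_pos.ne'⟩
    have hbt : (⊥ : Subrepresentation σ) ≠ ⊤ := fun h => hσ <| LinearMap.ext fun v => by
      have hv : ∀ w : Fin n → ℂ, w = 0 := fun w => by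
        have : w ∈ (⊤ : Subrepresentation σ) := Submodule.mem_top (R := ℂ)
        rw [← h] at this
        exact (Submodule.mem_bot ℂ).1 this
      rw [hv (σ g v), hv ((1 : Module.End ℂ _) v)]
    have hsub : ∀ T : Subrepresentation σ, T ≠ ⊤ → (∃ v ∈ T.toSubmodule, σ g v ≠ v) →
        ∃ (d : ℕ) (ρ : Representation ℂ G (Fin d → ℂ)), ρ.IsIrreducible ∧
          (∀ x, σ x = 1 → ρ x = 1) ∧ ρ g ≠ 1 := by
      rintro T hT ⟨v, hv, hne⟩
      obtain ⟨τ, hτ⟩ := Representation.exists_coordinates T.toRepresentation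
      have hlt : Module.finrank ℂ T.toSubmodule < n := by
        have := Submodule.finrank_lt (s := T.toSubmodule) fun h => hT
          (Subrepresentation.toSubmodule_injective h)
        simpa using this
      obtain ⟨d, ρ, h1, h2, h3⟩ := ih _ hlt τ fun h => hne <| by
        have := (hτ g).1 h
        exact congrArg Subtype.val (LinearMap.congr_fun this ⟨v, hv⟩)
      refine ⟨d, ρ, h1, fun x hx => h2 x ((hτ x).2 ?_), h3⟩
      ext w
      change (σ x w : Fin n → ℂ) _ = _
      rw [hx]
      rfl
    have : ∃ T : Subrepresentation σ, T ≠ ⊥ ∧ T ≠ ⊤ := by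
      by_contra! h
      exact hirr
        { exists_pair_ne := ⟨⊥, ⊤, hbt⟩
          eq_bot_or_eq_top := fun T => or_iff_not_imp_left.2 (h T) }
    obtain ⟨T, hT, hT'⟩ := this
    -- Maschke: if `g` were trivial on both summands it would be trivial, so the induction applies
    -- to one of them.
    obtain ⟨U, hU⟩ := exists_isCompl T
    by_contra hcon
    apply hσ
    have hfix : ∀ S : Subrepresentation σ, S ≠ ⊤ → ∀ v ∈ S.toSubmodule, σ g v = v := by
      intro S hS v hv
      by_contra hne
      exact hcon (hsub S hS ⟨v, hv, hne⟩)
    have hU' : U ≠ ⊤ := fun h => hT (by simpa [h] using hU.inf_eq_bot)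
    refine LinearMap.ext fun v => ?_
    have hv : v ∈ T.toSubmodule ⊔ U.toSubmodule := by
      rw [← Subrepresentation.toSubmodule_sup, hU.sup_eq_top]
      exact Submodule.mem_top
    obtain ⟨a, ha, b, hb, rfl⟩ := Submodule.mem_sup.1 hv
    rw [map_add, hfix T hT' a ha, hfix U hU' b hb]
    rfl

theorem exists_irreducible_apply_ne_one {G : Type*} [Group G] [Finite G] (N : Subgroup G)
    [N.Normal] {g : G} (hg : g ∉ N) :
    ∃ (d : ℕ) (ρ : Representation ℂ G (Fin d → ℂ)), ρ.IsIrreducible ∧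
      (∀ x ∈ N, ρ x = 1) ∧ ρ g ≠ 1 := by
  obtain ⟨τ, hτ⟩ := Representation.exists_coordinates (Representation.ofMulAction ℂ G (G ⧸ N))
  obtain ⟨d, ρ, h1, h2, h3⟩ := Representation.exists_irreducible_of_apply_ne_one g _ τ fun h => by
    have := LinearMap.congr_fun ((hτ g).1 h) (MonoidAlgebra.single (1 : G ⧸ N) (1 : ℂ))
    rw [Representation.ofMulAction_single] at this
    have h1 := MonoidAlgebra.single_left_injective (one_ne_zero (α := ℂ)) this
    exact hg ((QuotientGroup.eq_one_iff g).1 (by simpa [← QuotientGroup.mk_one] using h1))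
  refine ⟨d, ρ, h1, fun x hx => h2 x ((hτ x).2 ?_), h3⟩
  ext q : 1
  obtain ⟨y, rfl⟩ := QuotientGroup.mk_surjective q
  have hy : x • (y : G ⧸ N) = y := by
    change ((x * y : G) : G ⧸ N) = y
    rw [eq_comm, QuotientGroup.eq]
    simpa [mul_assoc] using Subgroup.Normal.conj_mem ‹N.Normal› x hx y⁻¹
  ext
  simp [hy]

/-! ### Centers of irreducible characters -/

/-- A complex linear operator of finite order whose trace has the largest possible norm is
scalar. -/
theorem Module.End.exists_eq_smul_one_of_norm_trace {V : Type*} [AddCommGroup V] [Module ℂ V]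
    [FiniteDimensional ℂ V] {m : ℕ} (hm : m ≠ 0) (f : Module.End ℂ V) (hf : f ^ m = 1)
    (htr : ‖LinearMap.trace ℂ V f‖ = Module.finrank ℂ V) :
    ∃ c : ℂ, f = c • 1 := by
  set d := Module.finrank ℂ V with hd0
  rcases Nat.eq_zero_or_pos d with hd | hd
  · have : Subsingleton V := Module.finrank_zero_iff.1 hd
    exact ⟨0, LinearMap.ext fun v => Subsingleton.elim _ _⟩
  have hd' : (d : ℂ) ≠ 0 := by exact_mod_cast hd.ne'
  set c : ℂ := LinearMap.trace ℂ V f / d with hc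
  have hcn : ‖c‖ = 1 := by
    rw [hc, norm_div, htr, Complex.norm_natCast, div_self (by exact_mod_cast hd.ne')]
  have hmin : minpoly ℂ f ∣ Polynomial.X ^ m - 1 := minpoly.dvd _ _ (by simp [hf])
  have hroot : ∀ z ∈ f.charpoly.roots, ‖z‖ = 1 := by
    intro z hz
    have h1 := (Module.End.hasEigenvalue_iff_isRoot_charpoly f z).2 (Polynomial.isRoot_of_mem_roots hz)
    have h2 := (Module.End.hasEigenvalue_iff_isRoot.1 h1).dvd hmin
    have h3 : z ^ m = 1 := by
      simpa [sub_eq_zero] using h2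
    exact Complex.norm_eq_one_of_pow_eq_one h3 hm
  have hcard : Multiset.card f.charpoly.roots = d := by
    rw [← (IsAlgClosed.splits f.charpoly).natDegree_eq_card_roots, LinearMap.charpoly_natDegree]
  have hsum : LinearMap.trace ℂ V f = f.charpoly.roots.sum :=
    Module.End.trace_eq_sum_roots_charpoly_of_splits (IsAlgClosed.splits _)
  have hre : ∀ z, ‖z‖ = 1 → 0 ≤ 1 - (starRingEnd ℂ c * z).re := fun z hz => by
    have := Complex.re_le_norm (starRingEnd ℂ c * z)
    rw [norm_mul, RCLike.norm_conj, hcn, hz, one_mul] at this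
    linarith
  -- Equality case of the triangle inequality: `c` is the mean of the eigenvalues and has norm one,
  -- so the nonnegative numbers `1 - Re(c̄ z)` sum to zero.
  have hall : ∀ z ∈ f.charpoly.roots, z = c := by
    have h0 : (f.charpoly.roots.map fun z => 1 - (starRingEnd ℂ c * z).re).sum = 0 := by
      have h1 : (f.charpoly.roots.map fun z => (starRingEnd ℂ c * z).re).sum = d := by
        let φ : ℂ →+ ℝ := Complex.reAddGroupHom.comp (AddMonoidHom.mulLeft (starRingEnd ℂ c))
        have h2 := map_multiset_sum φ f.charpoly.roots
        rw [← hsum, show LinearMap.trace ℂ V f = c * d by rw [hc, div_mul_cancel₀ _ hd']] at h2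
        refine Eq.trans h2.symm ?_
        change (starRingEnd ℂ c * (c * d)).re = d
        rw [← mul_assoc, ← Complex.normSq_eq_conj_mul_self, Complex.normSq_eq_norm_sq, hcn]
        simp
      rw [Multiset.sum_map_sub, h1]
      simp [hcard]
    intro z hz
    have h2 := Multiset.all_zero_of_le_zero_le_of_sum_eq_zero
      (fun x hx => by
        obtain ⟨w, hw, rfl⟩ := Multiset.mem_map.1 hx
        exact hre w (hroot w hw)) h0 _ (Multiset.mem_map_of_mem _ hz)
    have h3 : (starRingEnd ℂ c * z).re = 1 := by linarith
    have h4 : ‖starRingEnd ℂ c * z‖ = 1 := by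
      rw [norm_mul, RCLike.norm_conj, hcn, hroot z hz, one_mul]
    have h5 : starRingEnd ℂ c * z = 1 := by
      have h6 := Complex.sq_norm_sub_sq_re (starRingEnd ℂ c * z)
      rw [h4, h3] at h6
      exact Complex.ext h3 (by rw [Complex.one_im]; exact pow_eq_zero_iff two_ne_zero |>.1 (by linarith))
    have h6 : c * starRingEnd ℂ c = 1 := by
      rw [Complex.mul_conj, Complex.normSq_eq_norm_sq, hcn]; simp
    calc z = c * starRingEnd ℂ c * z := by rw [h6, one_mul]
      _ = c := by rw [mul_assoc, h5, mul_one]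
  have hrep : f.charpoly.roots = Multiset.replicate d c := Multiset.eq_replicate.2 ⟨hcard, hall⟩
  refine ⟨c, ?_⟩
  -- The minimal polynomial is squarefree, as a divisor of `X ^ m - 1`, and divides `(X - c) ^ d`.
  have hdvd : minpoly ℂ f ∣ (Polynomial.X - Polynomial.C c) := by
    have hsq : Squarefree (minpoly ℂ f) :=
      (Polynomial.X_pow_sub_one_separable_iff.2 (by exact_mod_cast hm)).squarefree.squarefree_of_dvd
        hmin
    rw [← hsq.dvd_pow_iff_dvd hd.ne']
    have h := LinearMap.minpoly_dvd_charpoly f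
    rw [(IsAlgClosed.splits f.charpoly).eq_prod_roots_of_monic (LinearMap.charpoly_monic f), hrep]
      at h
    simpa using h
  obtain ⟨q, hq⟩ := hdvd
  have h0 : Polynomial.aeval f (Polynomial.X - Polynomial.C c) = 0 := by
    rw [hq, map_mul, minpoly.aeval, zero_mul]
  simpa [sub_eq_zero, Algebra.algebraMap_eq_smul_one] using h0

section Characters

variable {G : Type*} [Group G] [Finite G] {d : ℕ} (ρ : Representation ℂ G (Fin d → ℂ))

theorem mem_charCenter_iff_exists_smul (g : G) :
    g ∈ charCenter ρ.character ↔ ∃ c : ℂ, ρ g = c • 1 := by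
  have hcard : Nat.card G ≠ 0 := Nat.card_pos.ne'
  have hpow : ρ g ^ Nat.card G = 1 := by rw [← map_pow, pow_card_eq_one', map_one]
  have hiff : g ∈ charCenter ρ.character ↔ ‖ρ.character g‖ = d := by
    simp only [charCenter, Set.mem_ofPred_eq, Representation.char_one, Module.finrank_fin_fun]
    norm_cast
  rw [hiff]
  constructor
  · intro h
    exact Module.End.exists_eq_smul_one_of_norm_trace hcard (ρ g) hpow
      (by simpa [Representation.character] using h)
  · rintro ⟨c, hc⟩
    rcases Nat.eq_zero_or_pos d with rfl | hd
    · have : Subsingleton (Module.End ℂ (Fin 0 → ℂ)) := inferInstance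
      simp [Representation.character, Subsingleton.elim (ρ g) 0]
    have hcn : ‖c‖ = 1 := by
      rw [hc, smul_pow, one_pow] at hpow
      have h1 := congrArg (LinearMap.trace ℂ (Fin d → ℂ)) hpow
      have hd' : (d : ℂ) ≠ 0 := by exact_mod_cast hd.ne'
      have h2 : c ^ Nat.card G = 1 := by
        simpa [LinearMap.trace_one, hd'] using h1
      exact Complex.norm_eq_one_of_pow_eq_one h2 hcard
    simp [Representation.character, hc, LinearMap.trace_one, hcn]

/-- Schur's lemma: an operator `ρ g` commuting with the whole image is scalar. This turns character
centers into commutator conditions. -/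
theorem mem_charCenter_iff (hρ : ρ.IsIrreducible) (g : G) :
    g ∈ charCenter ρ.character ↔ ∀ h, ρ ⁅g, h⁆ = 1 := by
  have hcomm : ∀ h, ρ ⁅g, h⁆ = 1 ↔ ρ g * ρ h = ρ h * ρ g := fun h => by
    have hu : IsUnit (ρ (h * g)) := (Group.isUnit _).map ρ
    rw [← hu.mul_left_inj, ← map_mul, commutatorElement_def, one_mul, map_mul ρ h g,
      ← map_mul ρ g h]
    simp [mul_assoc]
  rw [mem_charCenter_iff_exists_smul]
  constructor
  · rintro ⟨c, hc⟩ h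
    rw [hcomm, hc]
    simp
  · intro h
    let f : ρ.IntertwiningMap ρ := ⟨ρ g, fun k => (hcomm k).1 (h k)⟩
    obtain ⟨c, hc⟩ :=
      Representation.IsIrreducible.algebraMap_intertwiningMap_bijective_of_isAlgClosed.2 f
    refine ⟨c, ?_⟩
    change f.toLinearMap = _
    rw [← hc]
    rfl

/-- For `g ∉ Z` some `⁅g, h⁆` acts as a scalar `c ≠ 1`, and conjugating `g⁻¹` by `h` multiplies its
character value by `c`, so that value is zero. Orthonormality then reads `|Z| d² = |G|`. -/
theorem index_eq_sq_of_commutator_le_charCenter (hρ : ρ.IsIrreducible) (Z : Subgroup G)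
    (hZ : charCenter ρ.character = (Z : Set G)) (hG : commutator G ≤ Z) : Z.index = d ^ 2 := by
  classical
  have := Fintype.ofFinite G
  have hcard : (Nat.card G : ℂ) ≠ 0 := by exact_mod_cast Nat.card_pos.ne'
  have : Invertible (Nat.card G : ℂ) := invertibleOfNonzero hcard
  have horth := Representation.char_orthonormal ρ ρ
  rw [if_pos ⟨Representation.Equiv.refl ρ⟩] at horth
  have hval : ∀ g, ρ.character g * ρ.character g⁻¹ = if g ∈ Z then (d : ℂ) ^ 2 else 0 := by
    intro g
    split_ifs with hg
    · have hg' : g ∈ charCenter ρ.character := by rw [hZ]; exact hg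
      obtain ⟨c, hc⟩ := (mem_charCenter_iff_exists_smul ρ g).1 hg'
      have hinv : c • ρ g⁻¹ = 1 := by
        rw [← one_mul (ρ g⁻¹), ← smul_mul_assoc, ← hc, ← map_mul, mul_inv_cancel, map_one]
      have h1 : ρ.character g = c * d := by
        simp [Representation.character, hc, LinearMap.trace_one]
      have h2 : c * ρ.character g⁻¹ = d := by
        have := congrArg (LinearMap.trace ℂ (Fin d → ℂ)) hinv
        simpa [Representation.character, LinearMap.trace_one] using this
      rw [h1, mul_right_comm, h2, sq]
    · have hg' : g ∉ charCenter ρ.character := by rw [hZ]; exact hg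
      rw [mem_charCenter_iff ρ hρ] at hg'
      push Not at hg'
      obtain ⟨h, hh⟩ := hg'
      have hmem : ⁅g, h⁆ ∈ charCenter ρ.character := by
        rw [hZ]
        exact hG (Subgroup.commutator_mem_commutator (Subgroup.mem_top g) (Subgroup.mem_top h))
      obtain ⟨c, hc⟩ := (mem_charCenter_iff_exists_smul ρ _).1 hmem
      have h1 : ρ.character g⁻¹ = c * ρ.character g⁻¹ := by
        conv_lhs => rw [← Representation.char_conj ρ g⁻¹ h,
          show h * g⁻¹ * h⁻¹ = g⁻¹ * ⁅g, h⁆ by rw [commutatorElement_def]; group]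
        simp [Representation.character, hc]
      have h2 : (1 - c) * ρ.character g⁻¹ = 0 := by
        rw [sub_mul, one_mul, ← h1, sub_self]
      rcases mul_eq_zero.1 h2 with h3 | h3
      · exact absurd (by rw [hc, ← sub_eq_zero.1 h3, one_smul]) hh
      · rw [h3, mul_zero]
  simp_rw [hval] at horth
  rw [Finset.sum_ite, Finset.sum_const_zero, add_zero, Finset.sum_const, nsmul_eq_mul] at horth
  have hZc : (Finset.univ.filter fun g => g ∈ Z).card = Nat.card Z := by
    rw [Nat.card_eq_fintype_card, Fintype.card_subtype]
  rw [hZc, ← Z.card_mul_index] at horth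
  have hZ0 : (Nat.card Z : ℂ) ≠ 0 := by exact_mod_cast Nat.card_pos.ne'
  have hI0 : (Z.index : ℂ) ≠ 0 := by exact_mod_cast Subgroup.index_ne_zero_of_finite
  push_cast at horth
  field_simp at horth
  exact_mod_cast horth.symm

end Characters

/-! ### Alternating forms, Pfaffians and Chevalley–Warning -/

/-- The determinant of an alternating matrix over a field is a square. -/
theorem Matrix.isSquare_det_of_alternating {K : Type*} [Field K] (n : ℕ) :
    ∀ {ι : Type*} [Fintype ι] [DecidableEq ι], Fintype.card ι = n → ∀ M : Matrix ι ι K,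
      (∀ i, M i i = 0) → (∀ i j, M j i = -M i j) → IsSquare M.det := by
  induction n using Nat.strong_induction_on with
  | _ n ih =>
    intro ι _ _ hn M hdiag hanti
    by_cases h0 : ∀ i j, M i j = 0
    · have hM : M = 0 := by ext i j; exact h0 i j
      rcases isEmpty_or_nonempty ι with he | he
      · rw [Matrix.det_isEmpty]; exact ⟨1, by simp⟩
      · rw [hM, Matrix.det_zero]; exact ⟨0, by simp⟩
    push Not at h0
    obtain ⟨i, j, hij⟩ := h0
    have hne : i ≠ j := fun h => hij (by rw [h, hdiag])
    -- Split off the hyperbolic plane of `i` and `j`, with determinant `M i j ^ 2`; the Schur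
    -- complement is again alternating and smaller.
    let p : ι → Prop := fun x => x = i ∨ x = j
    let A := M.toBlock p p
    let B := M.toBlock p (fun x => ¬ p x)
    let C := M.toBlock (fun x => ¬ p x) p
    let D := M.toBlock (fun x => ¬ p x) (fun x => ¬ p x)
    have hdet : M.det = (Matrix.fromBlocks A B C D).det := Matrix.det_toBlock M p
    let e : Fin 2 ≃ {x // p x} :=
      { toFun := ![⟨i, Or.inl rfl⟩, ⟨j, Or.inr rfl⟩]
        invFun := fun x => if x.1 = i then 0 else 1
        left_inv := fun x => by fin_cases x <;> simp [hne.symm]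
        right_inv := fun x => by
          obtain ⟨x, rfl | rfl⟩ := x
          · simp
          · simp [hne.symm] }
    have hA : A.det = M i j ^ 2 := by
      rw [← Matrix.det_submatrix_equiv_self e A, Matrix.det_fin_two]
      simp [A, e, Matrix.toBlock, hdiag, hanti i j, sq]
    have hAu : IsUnit A.det := by rw [hA]; exact (pow_ne_zero 2 hij).isUnit
    let _ : Invertible A := A.invertibleOfIsUnitDet hAu
    have hAt : A.transpose = -A := by ext x y; exact hanti x.1 y.1
    have hBt : B.transpose = -C := by ext x y; simp [B, C, Matrix.toBlock, hanti x.1 y.1]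
    have hDt : D.transpose = -D := by ext x y; exact hanti x.1 y.1
    rw [hdet, Matrix.det_fromBlocks₁₁, hA]
    refine IsSquare.mul ⟨M i j, sq _⟩ ?_
    have hlt : Fintype.card {x // ¬ p x} < n := by
      rw [← hn]
      exact Fintype.card_subtype_lt (x := i) (by simp [p])
    have hAit : (⅟ A).transpose = -⅟ A := by
      rw [Matrix.invOf_eq_nonsing_inv, Matrix.transpose_nonsing_inv, hAt]
      refine Matrix.inv_eq_right_inv ?_
      rw [neg_mul_neg, Matrix.mul_nonsing_inv _ hAu]
    -- In characteristic two skew-symmetry does not give a zero diagonal, so the diagonal of the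
    -- Schur complement is handled through this identity.
    have hform : ∀ w : {x // p x} → K, dotProduct w (A.mulVec w) = 0 := by
      intro w
      have hs : ∀ f : {x // p x} → K, ∑ x, f x = f ⟨i, Or.inl rfl⟩ + f ⟨j, Or.inr rfl⟩ :=
        fun f => by rw [← e.sum_comp, Fin.sum_univ_two]; rfl
      simp only [dotProduct, Matrix.mulVec, hs]
      simp only [A, Matrix.toBlock_apply, hdiag, hanti i j]
      ring
    refine ih _ hlt rfl _ ?_ ?_
    · intro x
      let w := (⅟ A).mulVec fun a => B a x
      have hw : (fun a => B a x) = A.mulVec w := by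
        rw [Matrix.mulVec_mulVec, mul_invOf_self, Matrix.one_mulVec]
      have hC : ∀ a, C x a = - B a x := fun a => hanti _ _
      have h1 : (C * ⅟ A * B) x x = -dotProduct (fun a => B a x) w := by
        rw [Matrix.mul_assoc, Matrix.mul_apply]
        simp only [dotProduct, hC, neg_mul, Finset.sum_neg_distrib]
        rfl
      have h2 := hform w
      rw [dotProduct_comm, ← hw] at h2
      rw [Matrix.sub_apply, h1, h2, neg_zero, sub_zero]
      exact hdiag _
    · intro x y
      have : (D - C * ⅟ A * B).transpose = -(D - C * ⅟ A * B) := by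
        have hCt : C.transpose = -B := by rw [← Matrix.transpose_transpose B, hBt]; simp
        rw [Matrix.transpose_sub, Matrix.transpose_mul, Matrix.transpose_mul, hDt, hBt, hCt, hAit]
        simp [Matrix.mul_assoc]
        abel
      exact congrFun (congrFun this x) y

open MvPolynomial in
/-- A linear system of alternating matrices of size `n` over a finite field, all of whose nonzero
members are invertible, has dimension at most `n / 2`. -/
theorem Matrix.two_mul_card_le_of_alternating {K : Type*} [Field K] [Finite K] {ι σ : Type*}
    [Fintype ι] [DecidableEq ι] [Fintype σ] [Nonempty ι] (M : σ → Matrix ι ι K)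
    (hdiag : ∀ s i, M s i i = 0) (hanti : ∀ s i j, M s j i = -M s i j)
    (hdet : ∀ x : σ → K, x ≠ 0 → (∑ s, x s • M s).det ≠ 0) :
    2 * Fintype.card σ ≤ Fintype.card ι := by
  classical
  have := Fintype.ofFinite K
  let P : Matrix ι ι (MvPolynomial σ K) := ∑ s, (X s : MvPolynomial σ K) • (M s).map C
  have hP : ∀ i j, P i j = ∑ s, X s * C (M s i j) := fun i j => by
    simp [P, Matrix.sum_apply]
  have heval : ∀ x : σ → K, eval x P.det = (∑ s, x s • M s).det := fun x => by
    rw [RingHom.map_det]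
    congr 1
    ext i j
    simp [hP, Matrix.sum_apply]
  -- The square root lives a priori in the fraction field; being integral, it is a polynomial `f`,
  -- the Pfaffian up to sign.
  have hsq : IsSquare P.det := by
    have h1 : IsSquare (algebraMap (MvPolynomial σ K) (FractionRing (MvPolynomial σ K)) P.det) := by
      rw [RingHom.map_det]
      refine Matrix.isSquare_det_of_alternating _ rfl _ ?_ ?_
      · intro i; simp [hP, hdiag]
      · intro i j; simp [hP, hanti _ i j]
    obtain ⟨r, hr⟩ := h1
    have hint : IsIntegral (MvPolynomial σ K) r := by
      refine IsIntegral.of_pow two_pos ?_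
      rw [sq, ← hr]
      exact isIntegral_algebraMap
    obtain ⟨f, rfl⟩ := (IsIntegrallyClosed.isIntegral_iff).1 hint
    exact ⟨f, IsFractionRing.injective _ (FractionRing (MvPolynomial σ K)) (by rw [hr, map_mul])⟩
  obtain ⟨f, hf⟩ := hsq
  have hdeg : P.det.totalDegree ≤ Fintype.card ι := by
    rw [Matrix.det_apply]
    refine totalDegree_finsetSum_le fun τ _ => ?_
    refine (totalDegree_smul_le _ _).trans ?_
    refine (totalDegree_finsetProd _ _).trans ?_
    refine (Finset.sum_le_card_nsmul _ _ 1 fun i _ => ?_).trans (by simp)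
    rw [hP]
    refine totalDegree_finsetSum_le fun s _ => ?_
    refine (totalDegree_mul _ _).trans ?_
    simp
  by_contra! hlt
  have hσ : Nonempty σ := by
    by_contra h
    rw [not_nonempty_iff] at h
    simp at hlt
  obtain ⟨s⟩ := hσ
  have hf0 : f ≠ 0 := by
    rintro rfl
    refine hdet (Pi.single s 1) (by simp) ?_
    rw [← heval, hf]
    simp
  have hfd : f.totalDegree < Fintype.card σ := by
    rw [hf, totalDegree_mul_of_isDomain hf0 hf0] at hdeg
    omega
  -- Chevalley–Warning: `f` has fewer degrees than variables, so its number of zeros is divisible by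
  -- `p`, yet the origin is the only one.
  obtain ⟨p, hp⟩ := CharP.exists K
  have hdvd := char_dvd_card_solutions p hfd
  have hone : Fintype.card {x : σ → K // eval x f = 0} = 1 := by
    rw [Fintype.card_eq_one_iff]
    have hz : ∀ x, eval x f = 0 ↔ x = 0 := by
      intro x
      constructor
      · intro h
        by_contra hx
        exact hdet x hx (by rw [← heval, hf, map_mul, h, mul_zero])
      · rintro rfl
        have : eval (0 : σ → K) P.det = 0 := by
          rw [heval]
          simp [Matrix.det_zero]
        rw [hf, map_mul] at this
        exact mul_self_eq_zero.1 this
    exact ⟨⟨0, (hz 0).2 rfl⟩, fun y => Subtype.ext ((hz _).1 y.2)⟩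
  rw [hone] at hdvd
  exact CharP.char_ne_one K p (Nat.dvd_one.1 hdvd)

/-- If every nonzero functional on `W` turns the alternating map `B` into a nondegenerate form,
then `2 * dim W ≤ dim V`. -/
theorem LinearMap.two_mul_finrank_le_of_isAlt {K V W : Type*} [Field K] [Finite K]
    [AddCommGroup V] [Module K V] [FiniteDimensional K V] [Nontrivial V]
    [AddCommGroup W] [Module K W] [FiniteDimensional K W] (B : V →ₗ[K] V →ₗ[K] W)
    (halt : ∀ v, B v v = 0)
    (hB : ∀ f : W →ₗ[K] K, f ≠ 0 → ∀ x, (∀ y, f (B y x) = 0) → x = 0) :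
    2 * Module.finrank K W ≤ Module.finrank K V := by
  let b := Module.finBasis K V
  let c := Module.finBasis K W
  have hanti : ∀ v w, B w v = - B v w := fun v w => by
    have := halt (v + w)
    simp only [map_add, LinearMap.add_apply, halt, zero_add, add_zero] at this
    exact eq_neg_of_add_eq_zero_left (by rw [← this])
  have : Nonempty (Fin (Module.finrank K V)) := ⟨⟨0, Module.finrank_pos⟩⟩
  have := Matrix.two_mul_card_le_of_alternating (K := K)
    (ι := Fin (Module.finrank K V)) (σ := Fin (Module.finrank K W))
    (fun s => Matrix.of fun i j => c.coord s (B (b i) (b j)))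
    (fun s i => by simp [halt]) (fun s i j => by simp [hanti (b i) (b j)]) ?_
  · simpa using this
  intro x hx hdet
  obtain ⟨v, hv, hv0⟩ := Matrix.exists_mulVec_eq_zero_iff.2 hdet
  -- The combination of the coordinate matrices with coefficients `x` is the Gram matrix of `f ∘ B`.
  let f : W →ₗ[K] K := ∑ s, x s • c.coord s
  have hf : f ≠ 0 := by
    intro h
    apply hx
    ext s
    have := LinearMap.congr_fun h (c s)
    simpa [f, LinearMap.sum_apply, Finsupp.single_apply] using this
  apply hv
  have h1 := hB f hf (∑ j, v j • b j) ?_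
  · ext j
    have := congrArg (b.repr · j) h1
    simpa [Finsupp.single_apply] using this
  intro y
  have h2 : f ∘ₗ B.flip (∑ j, v j • b j) = 0 := by
    refine b.ext fun i => ?_
    have := congrFun hv0 i
    simp only [Matrix.mulVec, dotProduct, Matrix.sum_apply, Matrix.smul_apply, Matrix.of_apply]
      at this
    change f (B (b i) (∑ j, v j • b j)) = 0
    simp only [map_sum, map_smul]
    rw [Pi.zero_apply] at this
    rw [← this]
    refine Finset.sum_congr rfl fun j _ => ?_
    simp [f, LinearMap.sum_apply, mul_comm]
  exact DFunLike.congr_fun h2 y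

/-! ### Commutator identities and pairings -/

section Commutators

variable {G : Type*} [Group G]

theorem commutatorElement_mul_left_of_mem_center {a b c : G} (h : ⁅b, c⁆ ∈ Subgroup.center G) :
    ⁅a * b, c⁆ = ⁅a, c⁆ * ⁅b, c⁆ := by
  rw [commutatorElement_mul_left_eq_conj_mul, (Subgroup.mem_center_iff.1 h a),
    mul_inv_cancel_right, ← Subgroup.mem_center_iff.1 h]

theorem commutatorElement_mul_right_of_mem_center {a b c : G} (h : ⁅a, c⁆ ∈ Subgroup.center G) :
    ⁅a, b * c⁆ = ⁅a, b⁆ * ⁅a, c⁆ := by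
  rw [commutatorElement_mul_right_eq_mul_conj, mul_assoc ⁅a, b⁆, (Subgroup.mem_center_iff.1 h b),
    mul_assoc, mul_inv_cancel_right]

theorem commutatorElement_pow_left_of_mem_center {a b : G} (h : ⁅a, b⁆ ∈ Subgroup.center G)
    (k : ℕ) : ⁅a ^ k, b⁆ = ⁅a, b⁆ ^ k := by
  induction k with
  | zero => simp
  | succ k ih => rw [pow_succ, commutatorElement_mul_left_of_mem_center h, ih, pow_succ]

theorem mem_center_of_commutatorElement_eq_one {x : G} (h : ∀ g : G, ⁅x, g⁆ = 1) :
    x ∈ Subgroup.center G :=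
  Subgroup.mem_center_iff.2 fun g => (commutatorElement_eq_one_iff_mul_comm.1 (h g)).symm

theorem commutatorElement_mem_commutator (x g : G) : ⁅x, g⁆ ∈ commutator G :=
  Subgroup.commutator_mem_commutator (Subgroup.mem_top x) (Subgroup.mem_top g)

theorem commutatorElement_eq_of_inv_mul_mem_center {x y g : G}
    (h : x⁻¹ * y ∈ Subgroup.center G) : ⁅x, g⁆ = ⁅y, g⁆ := by
  have h1 : ⁅x⁻¹ * y, g⁆ = 1 :=
    commutatorElement_eq_one_iff_mul_comm.2 (Subgroup.mem_center_iff.1 h g).symm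
  rw [show y = x * (x⁻¹ * y) by group, commutatorElement_mul_left_of_mem_center (by
    rw [h1]; exact one_mem _), h1, mul_one]

end Commutators

/-- A finite group has at most as many linear characters as elements. -/
theorem card_monoidHom_units_le (A : Type*) [Group A] [Finite A] :
    Finite (A →* ℂˣ) ∧ Nat.card (A →* ℂˣ) ≤ Nat.card A := by
  have : NeZero (Monoid.exponent (Abelianization A)) := ⟨Monoid.exponent_ne_zero_of_finite⟩
  have e : (A →* ℂˣ) ≃ (Abelianization A →* ℂˣ) := Abelianization.lift
  have h : Finite (Abelianization A) := inferInstance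
  have hf : Finite (Abelianization A →* ℂˣ) :=
    Finite.of_equiv _ (CommGroup.monoidHom_mulEquiv_of_hasEnoughRootsOfUnity
      (Abelianization A) ℂ).some.symm.toEquiv
  refine ⟨Finite.of_equiv _ e.symm, ?_⟩
  rw [Nat.card_congr e, CommGroup.card_monoidHom_of_hasEnoughRootsOfUnity]
  exact Nat.card_le_card_of_surjective _ (QuotientGroup.mk'_surjective (commutator A))

/-- A pairing with left kernel contained in `L` and right kernel containing `K` gives
`|P : L| ≤ |Q : K|`. -/
theorem Subgroup.index_le_index_of_pairing {P Q : Type*} [Group P] [Finite P] [Group Q] [Finite Q]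
    (L : Subgroup P) (K : Subgroup Q) [K.Normal] (β : P →* (Q →* ℂˣ))
    (hL : β.ker ≤ L) (hK : ∀ a, K ≤ (β a).ker) : L.index ≤ K.index := by
  obtain ⟨_, hcard⟩ := card_monoidHom_units_le (Q ⧸ K)
  calc L.index ≤ β.ker.index := Subgroup.index_antitone hL
    _ = Nat.card β.range := Subgroup.index_ker β
    _ ≤ Nat.card (Q ⧸ K →* ℂˣ) := by
      refine Nat.card_le_card_of_injective
        (fun f => QuotientGroup.lift K f.1 fun x hx => ?_) ?_
      · obtain ⟨a, ha⟩ := f.2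
        rw [← ha]
        exact hK a hx
      · intro f g h
        refine Subtype.ext (MonoidHom.ext fun q => ?_)
        exact DFunLike.congr_fun h (q : Q ⧸ K)
    _ ≤ K.index := hcard

theorem exists_monoidHom_units_apply_ne_one {P : Type*} [Group P] [Finite P] (K : Subgroup P)
    [K.Normal] (hK : commutator P ≤ K) {x : P} (hx : x ∉ K) :
    ∃ φ : P →* ℂˣ, K ≤ φ.ker ∧ φ x ≠ 1 := by
  have hc := Subgroup.Normal.quotient_commutative_iff_commutator_le.2 hK
  let _ : CommGroup (P ⧸ K) := { mul_comm := fun a b => hc.is_comm.comm a b }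
  have : NeZero (Monoid.exponent (P ⧸ K)) := ⟨Monoid.exponent_ne_zero_of_finite⟩
  obtain ⟨φ, hφ⟩ := CommGroup.exists_apply_ne_one_of_hasEnoughRootsOfUnity (P ⧸ K) ℂ
    (a := (x : P ⧸ K)) (by rwa [ne_eq, QuotientGroup.eq_one_iff])
  refine ⟨φ.comp (QuotientGroup.mk' K), fun y hy => ?_, hφ⟩
  rw [MonoidHom.mem_ker, MonoidHom.comp_apply, QuotientGroup.mk'_apply,
    (QuotientGroup.eq_one_iff y).2 hy, map_one]

theorem Subgroup.isCoatom_of_prime_index {G : Type*} [Group G] (K : Subgroup G)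
    (hK : K.index.Prime) : IsCoatom K := by
  refine ⟨fun h => hK.one_lt.ne' (by rw [h, Subgroup.index_top]), fun L hL => ?_⟩
  have h := Subgroup.relIndex_mul_index hL.le
  rcases hK.eq_one_or_self_of_dvd L.index ⟨_, by rw [mul_comm, h]⟩ with h1 | h1
  · exact Subgroup.index_eq_one.1 h1
  · rw [h1] at h
    have h2 : K.relIndex L = 1 := Nat.eq_of_mul_eq_mul_right hK.pos (by rw [h, one_mul])
    exact absurd (Subgroup.relIndex_eq_one.1 h2) (not_le_of_gt hL)

/-! ### Class-two groups: semi-extraspecial quotients and the lower bound -/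

/-- A finite group whose center equals the derived subgroup and contains all `p`-th powers, for a
prime `p`, has its center as Frattini subgroup. -/
theorem frattini_eq_center {G : Type*} [Group G] [Finite G] {p : ℕ} (hp : p.Prime)
    (hcomm : commutator G = Subgroup.center G)
    (hpow : ∀ g : G, g ^ p ∈ Subgroup.center G) : frattini G = Subgroup.center G := by
  apply le_antisymm
  · intro x hx
    by_contra hxZ
    obtain ⟨φ, hφ, hφx⟩ := exists_monoidHom_units_apply_ne_one (Subgroup.center G) hcomm.le hxZ
    -- `φ` takes values in the `p`-th roots of unity, so its kernel is a maximal subgroup missing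
    -- `x`.
    have hdvd : φ.ker.index ∣ p := by
      have : NeZero p := ⟨hp.ne_zero⟩
      rw [Subgroup.index_ker, ← Complex.card_rootsOfUnity p]
      refine Subgroup.card_dvd_of_le ?_
      rintro _ ⟨g, rfl⟩
      rw [mem_rootsOfUnity, ← map_pow]
      exact hφ (hpow g)
    have hne : φ.ker.index ≠ 1 := fun h => hφx (by
      rw [Subgroup.index_eq_one] at h
      exact MonoidHom.mem_ker.1 (h ▸ Subgroup.mem_top x))
    have hprime : φ.ker.index.Prime := by
      rwa [(hp.eq_one_or_self_of_dvd _ hdvd).resolve_left hne]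
    exact hφx (frattini_le_coatom (Subgroup.isCoatom_of_prime_index _ hprime) hx)
  · refine le_iInf₂ fun K hK => ?_
    by_contra hle
    have hlt : K < K ⊔ Subgroup.center G := left_lt_sup.2 hle
    have htop := hK.2 _ hlt
    -- Central factors do not affect commutators, so `G = K Z(G)` gives `G' = K'`.
    have hcK : commutator G ≤ K := by
      have hmem : ∀ g : G, ∃ k ∈ K, ∃ z ∈ Subgroup.center G, k * z = g := fun g => by
        have : g ∈ K ⊔ Subgroup.center G := by rw [htop]; trivial
        exact Subgroup.mem_sup_of_normal_right.1 this
      refine Subgroup.commutator_le.2 fun a _ b _ => ?_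
      obtain ⟨k, hk, z, hz, rfl⟩ := hmem a
      obtain ⟨l, hl, w, hw, rfl⟩ := hmem b
      have h1 : ⁅k * z, l * w⁆ = ⁅k, l * w⁆ := by
        rw [← commutatorElement_eq_of_inv_mul_mem_center (x := k) (y := k * z) (by simpa using hz)]
      have h2 : ⁅k, l * w⁆ = ⁅k, l⁆ := by
        rw [← commutatorElement_inv, ← commutatorElement_inv l,
          ← commutatorElement_eq_of_inv_mul_mem_center (x := l) (y := l * w) (by simpa using hw)]
      rw [h1, h2, commutatorElement_def]
      exact K.mul_mem (K.mul_mem (K.mul_mem hk hl) (K.inv_mem hk)) (K.inv_mem hl)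
    exact hle (hcomm ▸ hcK)

/-- Condition under which a `p`-group of class two is semi-extraspecial. -/
theorem isSemiExtraspecial_of_commutator_le {H : Type*} [Group H] [Finite H] {p : ℕ}
    (hp : p.Prime) (hH : IsPGroup p H) (hcomm : commutator H = Subgroup.center H)
    (hsep : ∀ x ∉ Subgroup.center H, ∀ N : Subgroup H, N.Normal → (∀ g : H, ⁅x, g⁆ ∈ N) →
      commutator H ≤ N) : IsSemiExtraspecial p H := by
  refine ⟨hH, fun L hLn hLZ hLp => ?_⟩
  have hZ : (Subgroup.center H).map (QuotientGroup.mk' L) = Subgroup.center (H ⧸ L) := by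
    apply le_antisymm
    · rintro _ ⟨z, hz, rfl⟩
      refine mem_center_of_commutatorElement_eq_one fun q => ?_
      obtain ⟨g, rfl⟩ := QuotientGroup.mk'_surjective L q
      rw [← map_commutatorElement, commutatorElement_eq_one_iff_mul_comm.2
        (Subgroup.mem_center_iff.1 hz g).symm, map_one]
    · intro q hq
      obtain ⟨x, rfl⟩ := QuotientGroup.mk'_surjective L q
      refine ⟨x, ?_, rfl⟩
      by_contra hx
      have hle : commutator H ≤ L := by
        refine hsep x hx L hLn fun g => ?_
        rw [← QuotientGroup.eq_one_iff, ← QuotientGroup.mk'_apply, map_commutatorElement,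
          commutatorElement_eq_one_iff_mul_comm]
        exact (Subgroup.mem_center_iff.1 hq _).symm
      rw [hcomm] at hle
      rw [Subgroup.relIndex_eq_one.2 hle] at hLp
      exact hp.one_lt.ne hLp
  have hcard : Nat.card (Subgroup.center (H ⧸ L)) = p := by
    rw [← hZ, ← Subgroup.relIndex_ker, QuotientGroup.ker_mk', hLp]
  have hcommQ : commutator (H ⧸ L) = Subgroup.center (H ⧸ L) := by
    rw [← hZ, ← hcomm, commutator_def, commutator_def, Subgroup.map_commutator,
      Subgroup.map_top_of_surjective _ (QuotientGroup.mk'_surjective L)]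
  refine ⟨hH.to_quotient L, hcard, hcommQ, frattini_eq_center hp hcommQ fun q => ?_⟩
  refine mem_center_of_commutatorElement_eq_one fun r => ?_
  have hmem : ⁅q, r⁆ ∈ Subgroup.center (H ⧸ L) := hcommQ ▸ commutatorElement_mem_commutator q r
  rw [commutatorElement_pow_left_of_mem_center hmem]
  have := pow_card_eq_one' (x := (⟨_, hmem⟩ : Subgroup.center (H ⧸ L)))
  rw [hcard] at this
  exact congrArg Subtype.val this

/-- Over the prime field additive maps are linear, so the dimension bound becomes one on orders. -/
theorem AddMonoidHom.card_sq_le_of_alternating {V W : Type*} [AddCommGroup V] [AddCommGroup W]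
    [Finite V] [Finite W] [Nontrivial V] {p : ℕ} [Fact p.Prime] [Module (ZMod p) V]
    [Module (ZMod p) W] (B : V →+ V →+ W) (halt : ∀ v, B v v = 0)
    (hB : ∀ f : W →+ ZMod p, f ≠ 0 → ∀ x, (∀ y, f (B y x) = 0) → x = 0) :
    Nat.card W ^ 2 ≤ Nat.card V := by
  let B' : V →ₗ[ZMod p] V →ₗ[ZMod p] W := LinearMap.mk₂ (ZMod p) (fun v w => B v w)
    (fun v v' w => by simp) (fun c v w => ZMod.map_smul (B.flip w) c v)
    (fun v w w' => by simp) (fun c v w => ZMod.map_smul (B v) c w)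
  have hmain := LinearMap.two_mul_finrank_le_of_isAlt B' halt fun f hf x hx =>
    hB f.toAddMonoidHom (fun h => hf (LinearMap.ext fun w => DFunLike.congr_fun h w)) x hx
  rw [Module.natCard_eq_pow_finrank (K := ZMod p) (V := V),
    Module.natCard_eq_pow_finrank (K := ZMod p) (V := W), Nat.card_zmod, ← pow_mul, mul_comm]
  exact Nat.pow_le_pow_right (Fact.out : p.Prime).pos hmain

/-- In a `p`-group of class two in which every noncentral element has all of the derived subgroup
as its set of commutators, `|H'| ^ 2 ≤ |H : Z(H)|`. -/
theorem card_commutator_sq_le_index_center {H : Type*} [Group H] [Finite H] {p : ℕ}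
    (hp : p.Prime) (hH : IsPGroup p H) (hcomm : commutator H ≤ Subgroup.center H)
    (hne : commutator H ≠ ⊥)
    (hsep : ∀ x ∉ Subgroup.center H, ∀ N : Subgroup H, N ≤ Subgroup.center H →
      (∀ g : H, ⁅x, g⁆ ∈ N) → commutator H ≤ N) :
    Nat.card (commutator H) ^ 2 ≤ (Subgroup.center H).index := by
  have hmem : ∀ x g : H, ⁅x, g⁆ ∈ Subgroup.center H := fun x g =>
    hcomm (commutatorElement_mem_commutator x g)
  have hZtop : Subgroup.center H ≠ ⊤ := fun h => hne ((commutator_eq_bot_iff_center_eq_top H).2 h)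
  obtain ⟨y, hy⟩ : ∃ y, y ∉ Subgroup.center H := by
    by_contra! h
    exact hZtop ((Subgroup.eq_top_iff' _).2 h)
  -- The last noncentral term among `y, y^p, y^(p²), …`. Then `[x, g]^p = [x^p, g] = 1`, and
  -- separation spreads exponent `p` to all of `H'`.
  obtain ⟨x, hx, hxp⟩ : ∃ x, x ∉ Subgroup.center H ∧ x ^ p ∈ Subgroup.center H := by
    have hex : ∃ k, y ^ p ^ k ∈ Subgroup.center H := by
      obtain ⟨k, hk⟩ := hH y
      exact ⟨k, by rw [hk]; exact one_mem _⟩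
    classical
    have hk := Nat.find_spec hex
    obtain ⟨k, hk0⟩ : ∃ k, Nat.find hex = k + 1 := by
      refine Nat.exists_eq_succ_of_ne_zero fun h => ?_
      rw [h] at hk
      exact hy (by simpa using hk)
    refine ⟨y ^ p ^ k, Nat.find_min hex (by omega), ?_⟩
    rw [← pow_mul, ← pow_succ, ← hk0]
    exact hk
  have hexpC : ∀ c ∈ commutator H, c ^ p = 1 := by
    intro c hc
    let N : Subgroup H :=
      { carrier := {z | z ∈ Subgroup.center H ∧ z ^ p = 1}
        one_mem' := ⟨one_mem _, one_pow p⟩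
        mul_mem' := fun {a b} ha hb => ⟨mul_mem ha.1 hb.1, by
          have hc : Commute a b := Subgroup.mem_center_iff.1 hb.1 a
          rw [hc.mul_pow, ha.2, hb.2, one_mul]⟩
        inv_mem' := fun {a} ha => ⟨inv_mem ha.1, by rw [inv_pow, ha.2, inv_one]⟩ }
    have hN : commutator H ≤ N := by
      refine hsep x hx N (fun z hz => hz.1) fun g => ⟨hmem x g, ?_⟩
      rw [← commutatorElement_pow_left_of_mem_center (hmem x g)]
      exact commutatorElement_eq_one_iff_mul_comm.2 (Subgroup.mem_center_iff.1 hxp g).symm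
    exact (hN hc).2
  have hexpZ : ∀ g : H, g ^ p ∈ Subgroup.center H := fun g =>
    mem_center_of_commutatorElement_eq_one fun h => by
      rw [commutatorElement_pow_left_of_mem_center (hmem g h),
        hexpC _ (commutatorElement_mem_commutator g h)]
  have hqc := Subgroup.Normal.quotient_commutative_iff_commutator_le.2 hcomm
  let _ : CommGroup (H ⧸ Subgroup.center H) := { mul_comm := fun a b => hqc.is_comm.comm a b }
  let _ : CommGroup (commutator H) :=
    { mul_comm := fun a b => Subtype.ext (Subgroup.mem_center_iff.1 (hcomm b.2) a) }
  let V := Additive (H ⧸ Subgroup.center H)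
  let W := Additive (commutator H)
  have hV : ∀ v : V, p • v = 0 := fun v => by
    obtain ⟨g, hg⟩ := QuotientGroup.mk_surjective v.toMul
    change v.toMul ^ p = 1
    rw [← hg, ← QuotientGroup.mk_pow]
    exact (QuotientGroup.eq_one_iff _).2 (hexpZ g)
  have hW : ∀ w : W, p • w = 0 := fun v => Subtype.ext (hexpC _ v.toMul.2)
  -- Coset representatives; commutators depend only on classes modulo the center, so the choice is
  -- harmless.
  let r : V → H := fun v => Quotient.out v.toMul
  have hr : ∀ v, (r v : H ⧸ Subgroup.center H) = v.toMul := fun v => Quotient.out_eq v.toMul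
  let β : H → H → W := fun g h => Additive.ofMul ⟨⁅g, h⁆, commutatorElement_mem_commutator g h⟩
  have hβl : ∀ a b c, β (a * b) c = β a c + β b c := fun a b c =>
    Subtype.ext (commutatorElement_mul_left_of_mem_center (hmem b c))
  have hβr : ∀ a b c, β a (b * c) = β a b + β a c := fun a b c =>
    Subtype.ext (commutatorElement_mul_right_of_mem_center (hmem a c))
  have hβcl : ∀ {a b : H} (c), (a : H ⧸ Subgroup.center H) = b → β a c = β b c := fun c h =>
    Subtype.ext (commutatorElement_eq_of_inv_mul_mem_center (QuotientGroup.eq.1 h))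
  have hβanti : ∀ a b, β a b = - β b a := fun a b =>
    Subtype.ext (commutatorElement_inv b a).symm
  have hβcr : ∀ {a b : H} (c), (a : H ⧸ Subgroup.center H) = b → β c a = β c b := fun c h => by
    rw [hβanti, hβcl c h, ← hβanti]
  have hradd : ∀ v w, (r (v + w) : H ⧸ Subgroup.center H) = (r v * r w : H) := fun v w => by
    rw [hr, QuotientGroup.mk_mul, hr, hr]; rfl
  have hadd₁ : ∀ v v' w, β (r (v + v')) (r w) = β (r v) (r w) + β (r v') (r w) := fun v v' w =>
    (hβcl _ (hradd v v')).trans (hβl _ _ _)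
  have hadd₂ : ∀ v w w', β (r v) (r (w + w')) = β (r v) (r w) + β (r v) (r w') := fun v w w' =>
    (hβcr _ (hradd w w')).trans (hβr _ _ _)
  let B : V →+ V →+ W := AddMonoidHom.mk' (fun v => AddMonoidHom.mk' (fun w => β (r v) (r w))
      (hadd₂ v)) fun v v' => AddMonoidHom.ext fun w => hadd₁ v v' w
  have hB : ∀ v w, B v w = β (r v) (r w) := fun v w => rfl
  have hVnt : Nontrivial V := ⟨⟨Additive.ofMul (y : H ⧸ Subgroup.center H), 0, fun h =>
    hy ((QuotientGroup.eq_one_iff y).1 h)⟩⟩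
  have : Fact p.Prime := ⟨hp⟩
  let _ : Module (ZMod p) V := AddCommGroup.zmodModule hV
  let _ : Module (ZMod p) W := AddCommGroup.zmodModule hW
  refine AddMonoidHom.card_sq_le_of_alternating (V := V) (W := W) (p := p) B
    (fun v => by rw [hB]; exact Subtype.ext (commutatorElement_self _)) ?_
  intro f hf v hv
  by_contra hv0
  apply hf
  have hxv : r v ∉ Subgroup.center H := fun h => hv0 (by
    have := (QuotientGroup.eq_one_iff (r v)).2 h
    rw [hr] at this
    exact this)
  let N : Subgroup H :=
    { carrier := {h | ∃ hc : h ∈ commutator H, f (Additive.ofMul ⟨h, hc⟩) = 0}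
      one_mem' := ⟨one_mem _, f.map_zero⟩
      mul_mem' := by
        rintro a b ⟨ha, ha'⟩ ⟨hb, hb'⟩
        refine ⟨mul_mem ha hb, ?_⟩
        have := f.map_add (Additive.ofMul ⟨a, ha⟩) (Additive.ofMul ⟨b, hb⟩)
        rw [ha', hb', add_zero] at this
        exact this
      inv_mem' := by
        rintro a ⟨ha, ha'⟩
        refine ⟨inv_mem ha, ?_⟩
        have := f.map_neg (Additive.ofMul ⟨a, ha⟩)
        rw [ha', neg_zero] at this
        exact this }
  have hN : commutator H ≤ N := by
    refine hsep (r v) hxv N (fun h hh => hcomm hh.1) fun g => ?_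
    refine ⟨commutatorElement_mem_commutator _ _, ?_⟩
    change f (β (r v) g) = 0
    have h1 := hv (Additive.ofMul (g : H ⧸ Subgroup.center H))
    have h2 : β (r (Additive.ofMul (g : H ⧸ Subgroup.center H))) (r v) = β g (r v) := hβcl _ (hr _)
    rw [hB, h2] at h1
    rw [hβanti, map_neg, h1, neg_zero]
  refine AddMonoidHom.ext fun w => ?_
  exact (hN w.toMul.2).2

/-! ### The upper bound by two pairings -/

/-- Suppose `[Y, H]` is cyclic and central, `H' ≤ Y`, `H'` is not central, and every element
outside `Y` that is central modulo a normal subgroup `N` forces `H' ≤ N`. Then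
`|H : Y| ≤ |H' : H' ∩ Z(H)| ^ 2`. -/
theorem index_le_relIndex_center_commutator_sq {H : Type*} [Group H] [Finite H]
    (Y : Subgroup H) (hYZ : ⁅Y, (⊤ : Subgroup H)⁆ ≤ Subgroup.center H) [IsCyclic ↥⁅Y, (⊤ : Subgroup H)⁆]
    (hHY : commutator H ≤ Y) (hHZ : ¬ commutator H ≤ Subgroup.center H)
    (hsep : ∀ x ∉ Y, ∀ N : Subgroup H, N.Normal → (∀ g : H, ⁅x, g⁆ ∈ N) → commutator H ≤ N) :
    Y.index ≤ (Subgroup.center H).relIndex (commutator H) ^ 2 := by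
  set Z := Subgroup.center H with hZ
  have hYmem : ∀ y ∈ Y, ∀ g : H, ⁅y, g⁆ ∈ ⁅Y, (⊤ : Subgroup H)⁆ := fun y hy g =>
    Subgroup.commutator_mem_commutator hy (Subgroup.mem_top g)
  have hYc : ∀ y ∈ Y, ∀ g : H, ⁅y, g⁆ ∈ Z := fun y hy g => hYZ (hYmem y hy g)
  let E : Subgroup H := Subgroup.centralizer (commutator H : Set H)
  have hEn : E.Normal := inferInstance
  obtain ⟨ι, hι⟩ : ∃ ι : ↥⁅Y, (⊤ : Subgroup H)⁆ →* ℂˣ, Function.Injective ι := by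
    have : NeZero (Nat.card ↥⁅Y, (⊤ : Subgroup H)⁆) := ⟨Nat.card_pos.ne'⟩
    let e := mulEquivOfCyclicCardEq (G := ↥⁅Y, (⊤ : Subgroup H)⁆)
      (G' := rootsOfUnity (Nat.card ↥⁅Y, (⊤ : Subgroup H)⁆) ℂ) (Complex.card_rootsOfUnity _).symm
    exact ⟨(rootsOfUnity _ ℂ).subtype.comp e.toMonoidHom,
      Subtype.val_injective.comp e.injective⟩
  -- Pair `H` with `H'` by `(g, c) ↦ [c, g]`, with `[Y, H]` embedded in `ℂˣ` because it is cyclic.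
  have hE : E.index ≤ Z.relIndex (commutator H) := by
    have hmul₁ : ∀ c ∈ commutator H, ∀ g h : H, ⁅c, g * h⁆ = ⁅c, g⁆ * ⁅c, h⁆ := fun c hc g h =>
      commutatorElement_mul_right_of_mem_center (hYc c (hHY hc) h)
    let κ : H → commutator H → ↥⁅Y, (⊤ : Subgroup H)⁆ := fun g c =>
      ⟨⁅(c : H), g⁆, hYmem c (hHY c.2) g⟩
    let β : H →* (commutator H →* ℂˣ) := MonoidHom.mk' (fun g =>
      MonoidHom.mk' (fun c => ι (κ g c)) fun c d => by
        rw [← map_mul]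
        exact congrArg ι (Subtype.ext
          (commutatorElement_mul_left_of_mem_center (hYc d (hHY d.2) g)))) fun g h => by
        refine MonoidHom.ext fun c => ?_
        change ι (κ (g * h) c) = ι (κ g c) * ι (κ h c)
        rw [← map_mul]
        exact congrArg ι (Subtype.ext (hmul₁ c c.2 g h))
    refine Subgroup.index_le_index_of_pairing E (Z.subgroupOf (commutator H)) β ?_ ?_
    · intro g hg
      refine Subgroup.mem_centralizer_iff.2 fun c hc => ?_
      have h1 : ι (κ g ⟨c, hc⟩) = 1 := DFunLike.congr_fun hg (⟨c, hc⟩ : commutator H)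
      rw [← map_one ι] at h1
      exact commutatorElement_eq_one_iff_mul_comm.1 (congrArg Subtype.val (hι h1))
    · intro g c hc
      change ι (κ g c) = 1
      rw [← map_one ι]
      exact congrArg ι (Subtype.ext (commutatorElement_eq_one_iff_mul_comm.2
        (Subgroup.mem_center_iff.1 (Subgroup.mem_subgroupOf.1 hc) g).symm))
  -- Three subgroups lemma, from `[[E, H], E] ≤ [H', E] = 1`.
  have hEE : ∀ e ∈ E, ∀ f ∈ E, ⁅e, f⁆ ∈ Z := by
    have h1 : ⁅⁅E, (⊤ : Subgroup H)⁆, E⁆ = ⊥ := by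
      rw [eq_bot_iff]
      refine (Subgroup.commutator_mono (Subgroup.commutator_mono le_top le_rfl) le_rfl).trans ?_
      rw [Subgroup.commutator_comm]
      exact (Subgroup.commutator_eq_bot_iff_le_centralizer.2 le_rfl).le
    have h2 : ⁅⁅E, E⁆, (⊤ : Subgroup H)⁆ = ⊥ := by
      refine Subgroup.commutator_commutator_eq_bot_of_rotate h1 ?_
      rw [Subgroup.commutator_comm ⊤ E]
      exact h1
    intro e he f hf
    exact Subgroup.commutator_top_right_eq_bot_iff_le_center.1 h2
      (Subgroup.commutator_mem_commutator he hf)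
  -- Pair `E` with `H` by `(e, g) ↦ μ [e, g]`, where `μ` is a linear character of `Y` trivial on `Z`
  -- but not on `H'`. Since `[Y, H] ≤ Z`, `μ` is invariant under conjugation by `H`; this makes the
  -- pairing multiplicative in both arguments.
  have hEY : Y.relIndex E ≤ E.index := by
    obtain ⟨h, hhH, hhZ⟩ : ∃ h ∈ commutator H, h ∉ Z := by
      by_contra! hcon
      exact hHZ hcon
    obtain ⟨μ, hμZ, hμh⟩ := exists_monoidHom_units_apply_ne_one (P := Y) (Z.subgroupOf Y)
      (Subgroup.commutator_le.2 fun a _ b _ => Subgroup.mem_subgroupOf.2 (hYc a a.2 b))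
      (x := ⟨h, hHY hhH⟩) (fun hh => hhZ (Subgroup.mem_subgroupOf.1 hh))
    have hcY : ∀ e g : H, ⁅e, g⁆ ∈ Y := fun e g => hHY (commutatorElement_mem_commutator e g)
    have hμconj : ∀ (y : Y) (g : H) (hy : g * y * g⁻¹ ∈ Y), μ ⟨g * y * g⁻¹, hy⟩ = μ y := by
      intro y g hy
      have h1 : (⟨g * y * g⁻¹, hy⟩ * y⁻¹ : Y) ∈ Z.subgroupOf Y := by
        refine Subgroup.mem_subgroupOf.2 ?_
        change g * y * g⁻¹ * (y : H)⁻¹ ∈ Z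
        rw [← commutatorElement_def, ← commutatorElement_inv]
        exact Z.inv_mem (hYc y y.2 g)
      have h2 := hμZ h1
      rw [MonoidHom.mem_ker, map_mul, map_inv, mul_inv_eq_one] at h2
      exact h2
    have hYn : Y.Normal := Subgroup.Normal.of_commutator_le _ hHY
    let κ : E → H → Y := fun e g => ⟨⁅(e : H), g⁆, hcY e g⟩
    have hκr : ∀ e g h, μ (κ e (g * h)) = μ (κ e g) * μ (κ e h) := by
      intro e g h
      rw [← hμconj (κ e h) g (hYn.conj_mem _ (κ e h).2 g), ← map_mul]
      exact congrArg μ (Subtype.ext (by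
        simp only [κ, Subgroup.coe_mul]
        rw [commutatorElement_mul_right_eq_mul_conj]
        group))
    have hκl : ∀ e f g, μ (κ (e * f) g) = μ (κ e g) * μ (κ f g) := by
      intro e f g
      rw [mul_comm, ← hμconj (κ f g) e (hYn.conj_mem _ (κ f g).2 e), ← map_mul]
      exact congrArg μ (Subtype.ext (commutatorElement_mul_left_eq_conj_mul _ _ _))
    let β : E →* (H →* ℂˣ) := MonoidHom.mk' (fun e => MonoidHom.mk' (fun g => μ (κ e g)) (hκr e))
      fun e f => MonoidHom.ext fun g => hκl e f g
    refine Subgroup.index_le_index_of_pairing (Y.subgroupOf E) E β ?_ ?_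
    · intro e he
      by_contra heY
      -- The kernel of `μ` is normal in `H`; if it contained `[e, H]` with `e ∉ Y`, it would contain
      -- `H'`.
      have hle := hsep e (fun h => heY (Subgroup.mem_subgroupOf.2 h)) (μ.ker.map Y.subtype) ?_ ?_
      · obtain ⟨y, hy, hyh⟩ := hle hhH
        have : y = ⟨h, hHY hhH⟩ := Subtype.ext hyh
        exact hμh (this ▸ hy)
      · refine ⟨?_⟩
        rintro _ ⟨y, hy, rfl⟩ g
        refine ⟨⟨g * y * g⁻¹, hYn.conj_mem _ y.2 g⟩, ?_, rfl⟩
        exact (hμconj y g _).trans hy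
      · intro g
        exact ⟨κ e g, DFunLike.congr_fun he g, rfl⟩
    · intro e f hf
      exact hμZ (Subgroup.mem_subgroupOf.2 (hEE e e.2 f hf))
  calc Y.index ≤ (Y ⊓ E).index := Subgroup.index_antitone inf_le_left
    _ = Y.relIndex E * E.index := by
      rw [← Subgroup.inf_relIndex_right, Subgroup.relIndex_mul_index inf_le_right]
    _ ≤ E.index * E.index := Nat.mul_le_mul_right _ hEY
    _ ≤ _ := by rw [sq]; exact Nat.mul_le_mul hE hE

/-! ### Passage to quotients and complements -/

section Quotients

variable {G : Type*} [Group G]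

theorem QuotientGroup.mk'_mem_center_iff (N : Subgroup G) [N.Normal] (x : G) :
    QuotientGroup.mk' N x ∈ Subgroup.center (G ⧸ N) ↔ ∀ g : G, ⁅x, g⁆ ∈ N := by
  constructor
  · intro h g
    rw [← QuotientGroup.eq_one_iff, ← QuotientGroup.mk'_apply, map_commutatorElement,
      commutatorElement_eq_one_iff_mul_comm]
    exact (Subgroup.mem_center_iff.1 h _).symm
  · intro h
    refine mem_center_of_commutatorElement_eq_one fun q => ?_
    obtain ⟨g, rfl⟩ := QuotientGroup.mk'_surjective N q
    rw [← map_commutatorElement]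
    exact (QuotientGroup.eq_one_iff _).2 (h g)

theorem QuotientGroup.map_mk'_commutator (N : Subgroup G) [N.Normal] :
    (commutator G).map (QuotientGroup.mk' N) = commutator (G ⧸ N) := by
  rw [commutator_def, commutator_def, Subgroup.map_commutator,
    Subgroup.map_top_of_surjective _ (QuotientGroup.mk'_surjective N)]

theorem QuotientGroup.center_eq_map_mk' {N : Subgroup G} [N.Normal] {Y : Subgroup G}
    (hYN : ⁅Y, (⊤ : Subgroup G)⁆ ≤ N) (hY : ∀ x ∉ Y, ∃ g : G, ⁅x, g⁆ ∉ N) :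
    Subgroup.center (G ⧸ N) = Y.map (QuotientGroup.mk' N) := by
  apply le_antisymm
  · intro q hq
    obtain ⟨x, rfl⟩ := QuotientGroup.mk'_surjective N q
    refine ⟨x, ?_, rfl⟩
    by_contra hx
    obtain ⟨g, hg⟩ := hY x hx
    exact hg ((QuotientGroup.mk'_mem_center_iff N x).1 hq g)
  · rintro _ ⟨y, hy, rfl⟩
    exact (QuotientGroup.mk'_mem_center_iff N y).2 fun g =>
      hYN (Subgroup.commutator_mem_commutator hy (Subgroup.mem_top g))

theorem Subgroup.normal_of_commutator_top_le {Y N : Subgroup G} (hNY : N ≤ Y)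
    (hYN : ⁅Y, (⊤ : Subgroup G)⁆ ≤ N) : N.Normal :=
  Subgroup.commutator_top_right_le_iff.1 ((Subgroup.commutator_mono hNY le_rfl).trans hYN)

theorem QuotientGroup.commutator_le_of_separation {N : Subgroup G} [N.Normal] {Y : Subgroup G}
    (hsep : ∀ x ∉ Y, ∀ K : Subgroup G, K.Normal → (∀ g : G, ⁅x, g⁆ ∈ K) → commutator G ≤ K) :
    ∀ q ∉ Y.map (QuotientGroup.mk' N), ∀ K : Subgroup (G ⧸ N), K.Normal →
      (∀ r : G ⧸ N, ⁅q, r⁆ ∈ K) → commutator (G ⧸ N) ≤ K := by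
  intro q hq K hK h
  obtain ⟨x, rfl⟩ := QuotientGroup.mk'_surjective N q
  rw [← QuotientGroup.map_mk'_commutator, Subgroup.map_le_iff_le_comap]
  refine hsep x (fun hx => hq ⟨x, hx, rfl⟩) _ inferInstance fun g => ?_
  rw [Subgroup.mem_comap, map_commutatorElement]
  exact h _

/-- In a finite `p`-group, below any subgroup `B` and above a proper subgroup of `B`, there is a
subgroup of index `p` in `B`. -/
theorem IsPGroup.exists_relIndex_eq_of_lt [Finite G] {p : ℕ} (hp : p.Prime) (hG : IsPGroup p G)
    {A B : Subgroup G} (hAB : A < B) : ∃ M, A ≤ M ∧ M ≤ B ∧ M.relIndex B = p := by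
  have : Fact p.Prime := ⟨hp⟩
  have hB : IsPGroup p B := hG.to_subgroup B
  obtain ⟨b, hb⟩ := IsPGroup.iff_card.1 hB
  obtain ⟨a, ha⟩ := IsPGroup.iff_card.1 (hB.to_subgroup (A.subgroupOf B))
  have hlt : Nat.card (A.subgroupOf B) < Nat.card B := by
    refine lt_of_le_of_ne (Subgroup.card_le_card_group _) fun h => ?_
    exact hAB.not_ge (Subgroup.subgroupOf_eq_top.1 (Subgroup.eq_top_of_card_eq _ h))
  rw [ha, hb] at hlt
  have hab : a < b := (Nat.pow_lt_pow_iff_right hp.one_lt).1 hlt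
  obtain ⟨K, hK, hAK⟩ := Sylow.exists_subgroup_card_pow_prime_le p (m := b - 1)
    (by rw [hb]; exact pow_dvd_pow _ (by omega)) (A.subgroupOf B) ha (by omega)
  refine ⟨K.map B.subtype, ?_, Subgroup.map_subtype_le K, ?_⟩
  · intro x hx
    exact ⟨⟨x, hAB.le hx⟩, hAK (Subgroup.mem_subgroupOf.2 hx), rfl⟩
  · have h1 : (K.map B.subtype).relIndex B = K.index := by
      rw [Subgroup.relIndex, Subgroup.subgroupOf,
        Subgroup.comap_map_eq_self_of_injective B.subtype_injective]
    have h2 := K.card_mul_index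
    rw [hK, hb] at h2
    rw [h1]
    have h3 : p ^ b = p ^ (b - 1) * p := by rw [← pow_succ]; congr 1; omega
    rw [h3] at h2
    exact Nat.eq_of_mul_eq_mul_left (pow_pos hp.pos _) h2

/-- If `Y / X` is central in `G / X` and of exponent `p`, then any intermediate subgroup `T` has a
complement in `Y` modulo `X`. -/
theorem Subgroup.exists_complement_of_exponent [Finite G] {p : ℕ} (hp : p.Prime)
    {X T Y : Subgroup G} (hXT : X ≤ T) (hTY : T ≤ Y) (hYX : ⁅Y, (⊤ : Subgroup G)⁆ ≤ X)
    (hpow : ∀ y ∈ Y, y ^ p ∈ X) : ∃ A, X ≤ A ∧ A ≤ Y ∧ A ⊓ T = X ∧ A ⊔ T = Y := by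
  -- A maximal `A` meeting `T` inside `X`. If `x ∈ Y` were outside `A T`, adjoining it would
  -- preserve this condition: an `x ^ k ∈ A T` with `k` prime to `p` would return `x` itself.
  obtain ⟨A, -, hA⟩ := (Set.toFinite {A : Subgroup G | X ≤ A ∧ A ≤ Y ∧ A ⊓ T ≤ X}).exists_le_maximal
    (a := X) ⟨le_rfl, hXT.trans hTY, inf_le_left⟩
  obtain ⟨hXA, hAY, hAT⟩ := hA.prop
  refine ⟨A, hXA, hAY, le_antisymm hAT (le_inf hXA hXT), le_antisymm (sup_le hAY hTY) ?_⟩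
  intro x hx
  by_contra hxAT
  have hAn : A.Normal := Subgroup.normal_of_commutator_top_le hAY (hYX.trans hXA)
  have hmem : A ⊔ Subgroup.zpowers x ∈ {A : Subgroup G | X ≤ A ∧ A ≤ Y ∧ A ⊓ T ≤ X} := by
    refine ⟨hXA.trans le_sup_left, sup_le hAY (by rwa [Subgroup.zpowers_le]), ?_⟩
    rintro t ⟨ht, htT⟩
    obtain ⟨a, ha, z, hz, rfl⟩ := Subgroup.mem_sup_of_normal_left.1 ht
    obtain ⟨k, rfl⟩ := Subgroup.mem_zpowers_iff.1 hz
    have hxp : x ^ (p : ℤ) ∈ X := by rw [zpow_natCast]; exact hpow x hx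
    by_cases hk : (p : ℤ) ∣ k
    · obtain ⟨l, rfl⟩ := hk
      refine hAT ⟨A.mul_mem ha (hXA ?_), htT⟩
      rw [zpow_mul]
      exact X.zpow_mem hxp l
    · exfalso
      have hxk : x ^ k ∈ A ⊔ T := by
        have := (A ⊔ T).mul_mem (Subgroup.mem_sup_left (A.inv_mem ha)) (Subgroup.mem_sup_right htT)
        rwa [inv_mul_cancel_left] at this
      have hcop : IsCoprime (p : ℤ) k :=
        (Nat.prime_iff_prime_int.1 hp).coprime_iff_not_dvd.2 hk
      obtain ⟨u, v, huv⟩ := hcop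
      apply hxAT
      have : x = (x ^ (p : ℤ)) ^ u * (x ^ k) ^ v := by
        rw [← zpow_mul, ← zpow_mul, ← zpow_add, mul_comm _ u, mul_comm _ v, huv, zpow_one]
      rw [this]
      exact (A ⊔ T).mul_mem ((A ⊔ T).zpow_mem (Subgroup.mem_sup_left (hXA hxp)) u)
        ((A ⊔ T).zpow_mem hxk v)
  exact hxAT (Subgroup.mem_sup_left (hA.le_of_ge hmem le_sup_left
    (Subgroup.mem_sup_right (Subgroup.mem_zpowers x))))

end Quotients

/-! ### The chain of centers -/

namespace IsChainOfCenters

variable {G : Type*} [Group G] [Finite G] {n : ℕ} {X : ℕ → Subgroup G}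

omit [Finite G] in
theorem antitone (hX : IsChainOfCenters n X) {i j : ℕ} (hij : i ≤ j) (hj : j ≤ n) : X j ≤ X i := by
  rcases hij.eq_or_lt with rfl | h
  · exact le_rfl
  · exact (hX.anti i j h hj).le

theorem exists_irreducible (hX : IsChainOfCenters n X) {i : ℕ} (hi : i ≤ n) :
    ∃ (d : ℕ) (ρ : Representation ℂ G (Fin d → ℂ)), ρ.IsIrreducible ∧
      charCenter ρ.character = (X i : Set G) ∧ ∀ x, x ∈ X i ↔ ∀ g : G, ρ ⁅x, g⁆ = 1 := by
  obtain ⟨χ, ⟨d, ρ, hρ, rfl⟩, hχ⟩ := hX.exists_char i hi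
  refine ⟨d, ρ, hρ, hχ, fun x => ?_⟩
  rw [← mem_charCenter_iff ρ hρ, hχ, SetLike.mem_coe]

theorem exists_mem_iff (hX : IsChainOfCenters n X) {d : ℕ}
    (ρ : Representation ℂ G (Fin d → ℂ)) (hρ : ρ.IsIrreducible) :
    ∃ i ≤ n, ∀ x, x ∈ X i ↔ ∀ g : G, ρ ⁅x, g⁆ = 1 := by
  obtain ⟨i, hi, hχ⟩ := hX.center_mem ρ.character ⟨d, ρ, hρ, rfl⟩
  refine ⟨i, hi, fun x => ?_⟩
  rw [← mem_charCenter_iff ρ hρ, hχ, SetLike.mem_coe]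

theorem normal (hX : IsChainOfCenters n X) {i : ℕ} (hi : i ≤ n) : (X i).Normal := by
  obtain ⟨d, ρ, -, -, hmem⟩ := hX.exists_irreducible hi
  refine Subgroup.commutator_top_right_le_iff.1 (Subgroup.commutator_le.2 fun x hx g _ => ?_)
  have hk : ⁅x, g⁆ ∈ MonoidHom.ker ρ := (hmem x).1 hx g
  rw [hmem]
  intro h
  have := (MonoidHom.ker ρ).mul_mem hk
    ((MonoidHom.normal_ker ρ).conj_mem _ ((MonoidHom.ker ρ).inv_mem hk) h)
  rwa [← mul_assoc, ← mul_assoc] at this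

/-- If some element outside `X (i + 1)` is central modulo `N`, then so is all of `X i`. -/
theorem commutator_le_of_separation (hX : IsChainOfCenters n X) {i : ℕ} (hi : i + 1 ≤ n) (x : G)
    (hx : x ∉ X (i + 1)) (N : Subgroup G) (hN : N.Normal) (h : ∀ g : G, ⁅x, g⁆ ∈ N) :
    ⁅X i, (⊤ : Subgroup G)⁆ ≤ N := by
  refine Subgroup.commutator_le.2 fun y hy g _ => ?_
  by_contra hyg
  obtain ⟨d, ρ, hρ, hker, hne⟩ := exists_irreducible_apply_ne_one N hyg
  obtain ⟨j, hj, hmem⟩ := hX.exists_mem_iff ρ hρ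
  have hyj : y ∉ X j := fun hyj => hne ((hmem y).1 hyj g)
  have hij : i + 1 ≤ j := by
    by_contra! hlt
    exact hyj (hX.antitone (by omega) (by omega) hy)
  exact hx (hX.antitone hij hj ((hmem x).2 fun g => hker _ (h g)))

theorem one_le_of_nonabelian (hX : IsChainOfCenters n X) (hna : ¬ ∀ a b : G, a * b = b * a) :
    1 ≤ n := by
  by_contra! h0
  apply hna
  intro a b
  by_contra hab
  obtain ⟨d, ρ, hρ, -, hne⟩ := exists_irreducible_apply_ne_one (⊥ : Subgroup G) (g := ⁅a, b⁆)
    (fun h => hab (commutatorElement_eq_one_iff_mul_comm.1 (Subgroup.mem_bot.1 h)))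
  obtain ⟨j, hj, hmem⟩ := hX.exists_mem_iff ρ hρ
  have : j = 0 := by omega
  subst this
  exact hne ((hmem a).1 (by rw [hX.top]; trivial) b)

/-- A character with center `X (i+1)` has `[X (i+1), G]` in its kernel, so the inclusion would put
`X i` into its center. This leaves room for a subgroup of index `p` in the upper bound. -/
theorem not_commutator_le (hX : IsChainOfCenters n X) {i : ℕ} (hi : i + 1 ≤ n) :
    ¬ ⁅X i, (⊤ : Subgroup G)⁆ ≤ ⁅X (i + 1), (⊤ : Subgroup G)⁆ := by
  intro hle
  obtain ⟨d, ρ, -, -, hmem⟩ := hX.exists_irreducible hi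
  refine (hX.anti i (i + 1) (Nat.lt_succ_self i) hi).not_ge fun x hx => ?_
  have hker : ⁅X (i + 1), (⊤ : Subgroup G)⁆ ≤ MonoidHom.ker ρ :=
    Subgroup.commutator_le.2 fun y hy g _ => (hmem y).1 hy g
  exact (hmem x).2 fun g =>
    hker (hle (Subgroup.commutator_mem_commutator hx (Subgroup.mem_top g)))

/-- The nontrivial `p`-group `G / X (i+1)` has a nontrivial central element; separation applies to a
lift of it. -/
theorem commutator_le_succ (hX : IsChainOfCenters n X) {p : ℕ} (hp : p.Prime) (hG : IsPGroup p G)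
    {i : ℕ} (hi : i + 1 ≤ n) : ⁅X i, (⊤ : Subgroup G)⁆ ≤ X (i + 1) := by
  have : Fact p.Prime := ⟨hp⟩
  have hn := hX.normal hi
  have : Nontrivial (G ⧸ X (i + 1)) := QuotientGroup.nontrivial_iff.2 fun h =>
    (hX.anti i (i + 1) (Nat.lt_succ_self i) hi).not_ge (by rw [h]; exact le_top)
  have := (hG.to_quotient (X (i + 1))).center_nontrivial
  obtain ⟨⟨q, hq⟩, hq1⟩ := exists_ne (1 : Subgroup.center (G ⧸ X (i + 1)))
  obtain ⟨x, rfl⟩ := QuotientGroup.mk'_surjective _ q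
  refine hX.commutator_le_of_separation hi x (fun hx => hq1 (Subtype.ext ?_)) _ hn
    ((QuotientGroup.mk'_mem_center_iff _ x).1 hq)
  exact (QuotientGroup.eq_one_iff x).2 hx

theorem isSquare_index (hX : IsChainOfCenters n X) {i : ℕ} (hi : i ≤ n)
    (hG : commutator G ≤ X i) : IsSquare (X i).index := by
  obtain ⟨d, ρ, hρ, hχ, -⟩ := hX.exists_irreducible hi
  exact ⟨d, by rw [index_eq_sq_of_commutator_le_charCenter ρ hρ (X i) hχ hG, sq]⟩

end IsChainOfCenters

/-! ### Semi-extraspecial quotients and both bounds for a separated subgroup -/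

section SeparatedSubgroup

variable {G : Type*} [Group G] [Finite G] {p : ℕ} {Y : Subgroup G}

/-- Suppose that an element outside `Y` which is central modulo a normal subgroup `K` forces
`G' ≤ K`. If `[Y, G] ≤ N` and `N < N G' = Y`, then `G / N` is semi-extraspecial. -/
theorem isSemiExtraspecial_quotient (hp : p.Prime) (hG : IsPGroup p G)
    (hsep : ∀ x ∉ Y, ∀ K : Subgroup G, K.Normal → (∀ g : G, ⁅x, g⁆ ∈ K) → commutator G ≤ K)
    (N : Subgroup G) [N.Normal] (hYN : ⁅Y, (⊤ : Subgroup G)⁆ ≤ N) (hN : N < N ⊔ commutator G)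
    (hNY : N ⊔ commutator G = Y) :
    Subgroup.center (G ⧸ N) = Y.map (QuotientGroup.mk' N) ∧ IsSemiExtraspecial p (G ⧸ N) := by
  have hcenter : Subgroup.center (G ⧸ N) = Y.map (QuotientGroup.mk' N) := by
    refine QuotientGroup.center_eq_map_mk' hYN fun x hx => ?_
    by_contra! h
    exact (left_lt_sup.1 hN) (hsep x hx N inferInstance h)
  refine ⟨hcenter, isSemiExtraspecial_of_commutator_le hp (hG.to_quotient N) ?_ ?_⟩
  · rw [hcenter, ← hNY, Subgroup.map_sup, QuotientGroup.map_mk'_commutator,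
      (Subgroup.map_eq_bot_iff N).2 (QuotientGroup.ker_mk' N).ge, bot_sup_eq]
  · rw [hcenter]
    exact QuotientGroup.commutator_le_of_separation hsep

/-- The class-two bound applied to `G / [Y, G]`, whose center is `Y / [Y, G]`. -/
theorem relIndex_commutator_sq_le_index (hp : p.Prime) (hG : IsPGroup p G) [Y.Normal]
    (hsep : ∀ x ∉ Y, ∀ K : Subgroup G, K.Normal → (∀ g : G, ⁅x, g⁆ ∈ K) → commutator G ≤ K)
    (hGY : commutator G ≤ Y) (hne : ¬ commutator G ≤ ⁅Y, (⊤ : Subgroup G)⁆) :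
    (⁅Y, (⊤ : Subgroup G)⁆).relIndex (commutator G) ^ 2 ≤ Y.index := by
  set C := ⁅Y, (⊤ : Subgroup G)⁆ with hC
  have hCn : C.Normal := inferInstance
  have hker : (QuotientGroup.mk' C).ker = C := QuotientGroup.ker_mk' C
  have hcenter : Subgroup.center (G ⧸ C) = Y.map (QuotientGroup.mk' C) := by
    refine QuotientGroup.center_eq_map_mk' le_rfl fun x hx => ?_
    by_contra! h
    exact hne (hsep x hx C hCn h)
  have h := card_commutator_sq_le_index_center hp (hG.to_quotient C) ?_ ?_ ?_
  · rwa [hcenter, ← QuotientGroup.map_mk'_commutator, ← Subgroup.relIndex_ker, hker,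
      Subgroup.index_map_eq _ (QuotientGroup.mk'_surjective C)
        (hker.le.trans (Subgroup.commutator_le_left _ _))] at h
  · rw [hcenter, ← QuotientGroup.map_mk'_commutator]
    exact Subgroup.map_mono hGY
  · rw [← QuotientGroup.map_mk'_commutator, ne_eq, Subgroup.map_eq_bot_iff, hker]
    exact hne
  · rw [hcenter]
    intro q hq K hK
    refine QuotientGroup.commutator_le_of_separation hsep q hq K ?_
    exact Subgroup.normal_of_commutator_top_le (hK.trans hcenter.ge)
      ((Subgroup.commutator_top_right_eq_bot_iff_le_center.2 le_rfl).le.trans bot_le)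

/-- Pass to `G / M` with `[X, G] ≤ M` of index `p` in `[Y, G]`. By `hsep'` its center is `X / M`,
while `[Y, G] / M` is central of order `p`. Hence the pairing bound applies, and `[y^p, g] = [y,
g]^p` is trivial modulo `M`. -/
theorem index_le_relIndex_commutator_sq (hp : p.Prime) (hG : IsPGroup p G) [Y.Normal]
    (hsep : ∀ x ∉ Y, ∀ K : Subgroup G, K.Normal → (∀ g : G, ⁅x, g⁆ ∈ K) → commutator G ≤ K)
    (hGY : commutator G ≤ Y) {X : Subgroup G} (hYX : ⁅Y, (⊤ : Subgroup G)⁆ ≤ X)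
    (hXY : X ≤ Y) (hlt : ¬ ⁅Y, (⊤ : Subgroup G)⁆ ≤ ⁅X, (⊤ : Subgroup G)⁆)
    (hsep' : ∀ x ∉ X, ∀ K : Subgroup G, K.Normal → (∀ g : G, ⁅x, g⁆ ∈ K) →
      ⁅Y, (⊤ : Subgroup G)⁆ ≤ K) (hne : ¬ commutator G ≤ X) :
    Y.index ≤ X.relIndex (commutator G) ^ 2 ∧ ∀ y ∈ Y, y ^ p ∈ X := by
  have : Fact p.Prime := ⟨hp⟩
  obtain ⟨M, hXM, hMY, hMp⟩ := hG.exists_relIndex_eq_of_lt hp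
    (lt_of_le_not_ge (Subgroup.commutator_mono hXY le_rfl) hlt)
  have hMX : M ≤ X := hMY.trans hYX
  have hMn : M.Normal := Subgroup.normal_of_commutator_top_le hMX hXM
  have hker : (QuotientGroup.mk' M).ker = M := QuotientGroup.ker_mk' M
  have hsurj := QuotientGroup.mk'_surjective M
  have hcenter : Subgroup.center (G ⧸ M) = X.map (QuotientGroup.mk' M) := by
    refine QuotientGroup.center_eq_map_mk' hXM fun x hx => ?_
    by_contra! h
    rw [Subgroup.relIndex_eq_one.2 (hsep' x hx M hMn h)] at hMp
    exact hp.one_lt.ne hMp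
  have hcomm : ⁅Y.map (QuotientGroup.mk' M), (⊤ : Subgroup (G ⧸ M))⁆ =
      ⁅Y, (⊤ : Subgroup G)⁆.map (QuotientGroup.mk' M) := by
    rw [Subgroup.map_commutator, Subgroup.map_top_of_surjective _ hsurj]
  have hcard : Nat.card ↥⁅Y.map (QuotientGroup.mk' M), (⊤ : Subgroup (G ⧸ M))⁆ = p := by
    rw [hcomm, ← Subgroup.relIndex_ker, hker, hMp]
  have hcyc := isCyclic_of_prime_card hcard
  have hcentral : ⁅Y.map (QuotientGroup.mk' M), (⊤ : Subgroup (G ⧸ M))⁆ ≤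
      Subgroup.center (G ⧸ M) := by
    rw [hcomm, hcenter]
    exact Subgroup.map_mono hYX
  have hmemX : ∀ x, QuotientGroup.mk' M x ∈ Subgroup.center (G ⧸ M) → x ∈ X := fun x hx => by
    rw [hcenter, ← Subgroup.mem_comap, Subgroup.comap_map_eq, hker, sup_eq_left.2 hMX] at hx
    exact hx
  have hMG : M ≤ commutator G := hMY.trans (Subgroup.commutator_mono le_top le_rfl)
  constructor
  · have h := index_le_relIndex_center_commutator_sq (Y.map (QuotientGroup.mk' M)) hcentral ?_ ?_
      (QuotientGroup.commutator_le_of_separation hsep)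
    · rwa [hcenter, ← QuotientGroup.map_mk'_commutator,
        Subgroup.index_map_eq _ hsurj (hker.le.trans (hMX.trans hXY)), Subgroup.relIndex_map_map,
        hker, sup_eq_left.2 hMX, sup_eq_left.2 hMG] at h
    · rw [← QuotientGroup.map_mk'_commutator]
      exact Subgroup.map_mono hGY
    · rw [← QuotientGroup.map_mk'_commutator]
      exact fun h => hne fun x hx => hmemX x (h ⟨x, hx, rfl⟩)
  · intro y hy
    refine hmemX _ (mem_center_of_commutatorElement_eq_one fun r => ?_)
    have hmem : ⁅QuotientGroup.mk' M y, r⁆ ∈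
        ⁅Y.map (QuotientGroup.mk' M), (⊤ : Subgroup (G ⧸ M))⁆ :=
      Subgroup.commutator_mem_commutator ⟨y, hy, rfl⟩ (Subgroup.mem_top r)
    rw [map_pow, commutatorElement_pow_left_of_mem_center (hcentral hmem)]
    have := pow_card_eq_one'
      (x := (⟨_, hmem⟩ : ↥⁅Y.map (QuotientGroup.mk' M), (⊤ : Subgroup (G ⧸ M))⁆))
    rw [hcard] at this
    exact congrArg Subtype.val this

end SeparatedSubgroup

/-! ### The main theorem -/

theorem theorem1p5 {G : Type*} [Group G] [Finite G] (p : ℕ) (hp : p.Prime) (hG : IsPGroup p G)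
    (hna : ¬ ∀ a b : G, a * b = b * a) (hnest : IsNested G)
    (n : ℕ) (X : ℕ → Subgroup G) (hX : IsChainOfCenters n X) :
    IsSquare (X 1).index ∧
    (∀ i : ℕ, 1 ≤ i → i ≤ n → commutator G ≤ X i →
      ∀ j : ℕ, 1 ≤ j → j ≤ i → IsSquare (X j).index) ∧
    (∀ N : Subgroup G, ⁅X 1, (⊤ : Subgroup G)⁆ ≤ N → N < N ⊔ commutator G →
      N ⊔ commutator G = X 1 →
      ∃ _ : N.Normal, IsSemiExtraspecial p (G ⧸ N)) ∧
    (2 ≤ n → X 2 < X 2 ⊔ commutator G →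
      (X 1).index = (X 2).relIndex (X 2 ⊔ commutator G) ^ 2 ∧
      (X 1).index = ⁅X 1, (⊤ : Subgroup G)⁆.relIndex (commutator G) ^ 2 ∧
      X 2 ⊓ commutator G = ⁅X 1, (⊤ : Subgroup G)⁆ ∧
      ∃ A : Subgroup G, X 2 ≤ A ∧ A < X 1 ∧
        ∃ _ : A.Normal, IsUltraspecial p (G ⧸ A)) := by
  have hn : 1 ≤ n := hX.one_le_of_nonabelian hna
  have hX0 : ⁅X 0, (⊤ : Subgroup G)⁆ = commutator G := by rw [hX.top, commutator_def]
  have hGX : commutator G ≤ X 1 := hX0 ▸ hX.commutator_le_succ hp hG hn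
  have hsep : ∀ x ∉ X 1, ∀ K : Subgroup G, K.Normal → (∀ g : G, ⁅x, g⁆ ∈ K) →
      commutator G ≤ K := hX0 ▸ hX.commutator_le_of_separation hn
  refine ⟨hX.isSquare_index hn hGX, fun i _ hi hGi j _ hj =>
    hX.isSquare_index (hj.trans hi) (hGi.trans (hX.antitone hj hi)), fun N hXN hN hNX => ?_,
    fun hn2 hlt => ?_⟩
  · have hNn := Subgroup.normal_of_commutator_top_le (hNX ▸ le_sup_left) hXN
    exact ⟨hNn, (isSemiExtraspecial_quotient hp hG hsep N hXN hN hNX).2⟩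
  have hn₁ := hX.normal hn
  have hn₂ := hX.normal hn2
  have hX21 : X 2 ≤ X 1 := hX.antitone one_le_two hn2
  have hCX : ⁅X 1, (⊤ : Subgroup G)⁆ ≤ X 2 := hX.commutator_le_succ hp hG hn2
  have hCG : ⁅X 1, (⊤ : Subgroup G)⁆ ≤ commutator G := Subgroup.commutator_mono le_top le_rfl
  have hne : ¬ commutator G ≤ X 2 := left_lt_sup.1 hlt
  obtain ⟨hupper, hpow⟩ := index_le_relIndex_commutator_sq hp hG hsep hGX hCX hX21
    (hX.not_commutator_le hn2) (hX.commutator_le_of_separation hn2) hne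
  have hfin : ∀ K L : Subgroup G, K.relIndex L ≠ 0 := fun K L => Subgroup.index_ne_zero_of_finite
  have hlower := relIndex_commutator_sq_le_index hp hG hsep hGX fun h => hne (h.trans hCX)
  have hle : (X 2).relIndex (commutator G) ≤
      (⁅X 1, (⊤ : Subgroup G)⁆).relIndex (commutator G) :=
    Subgroup.relIndex_le_of_le_left hCX (hfin _ _)
  -- The two bounds sandwich `|G : X 1|`, which forces the two indices in `G'` to agree.
  have heq : (⁅X 1, (⊤ : Subgroup G)⁆).relIndex (commutator G) =
      (X 2).relIndex (commutator G) :=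
    le_antisymm ((Nat.pow_le_pow_iff_left two_ne_zero).1 (hlower.trans hupper)) hle
  have hindex : (X 1).index = (X 2).relIndex (commutator G) ^ 2 :=
    le_antisymm hupper (heq ▸ hlower)
  have hsup : (X 2).relIndex (X 2 ⊔ commutator G) = (X 2).relIndex (commutator G) :=
    Subgroup.relIndex_sup_left _ _
  refine ⟨by rw [hindex, hsup], by rw [hindex, heq], ?_, ?_⟩
  · refine le_antisymm ?_ (le_inf hCX hCG)
    have h := Subgroup.relIndex_mul_relIndex _ _ _ (le_inf hCX hCG)
      (inf_le_right : X 2 ⊓ commutator G ≤ commutator G)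
    rw [Subgroup.inf_relIndex_right, heq] at h
    exact Subgroup.relIndex_eq_one.1 (Nat.eq_of_mul_eq_mul_right
      (Nat.pos_of_ne_zero (hfin _ _)) (h.trans (one_mul _).symm))
  · obtain ⟨A, hXA, hAX, hinf, hsupA⟩ := Subgroup.exists_complement_of_exponent hp
      (le_sup_left : X 2 ≤ X 2 ⊔ commutator G) (sup_le hX21 hGX) hCX hpow
    have hAn := Subgroup.normal_of_commutator_top_le hAX (hCX.trans hXA)
    have hAG : A ⊔ commutator G = X 1 := by
      rw [← hsupA, ← sup_assoc, sup_eq_left.2 hXA]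
    have hAlt : A < X 1 := by
      refine lt_of_le_of_ne hAX fun h => hlt.ne' ?_
      rwa [h, inf_eq_right.2 (sup_le hX21 hGX)] at hinf
    obtain ⟨hcenter, hses⟩ := isSemiExtraspecial_quotient hp hG hsep A (hCX.trans hXA)
      (hAG ▸ hAlt) hAG
    refine ⟨A, hXA, hAlt, hAn, hses, ?_⟩
    -- `Z(G / A) = X 1 / A` has order `|X 2 G' : X 2|`, because `A` and `X 2 G'` generate `X 1` and
    -- meet in `X 2`.
    rw [hcenter, Subgroup.index_map_eq _ (QuotientGroup.mk'_surjective A)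
      ((QuotientGroup.ker_mk' A).le.trans hAX), ← Subgroup.relIndex_ker, QuotientGroup.ker_mk',
      hindex, ← hsupA, Subgroup.relIndex_sup_left, ← Subgroup.inf_relIndex_right A, hinf, hsup]
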